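/- Let $d\in\{1,2,3\}$, let $\Omega\subset\mathbb R^d$ be a bounded convex polygonal domain (the nonempty interior of the convex hull of finitely many points), $H=L_2(\Omega)$ with inner product $(\cdot,\cdot)$ and norm $\|\cdot\|$, $\mathcal V=H^1_0(\Omega)$, $a(v,w)=(\nabla v,\nabla w)$, and $A=-\Delta$ with $\mathrm{dom}(A)=H^2(\Omega)\cap\mathcal V$. Write $\|v\|_1=\|\nabla v\|$ on $\dot H^1=\mathcal V$ and $\|v\|_2=\|Av\|$ on $\dot H^2=\mathrm{dom}(A)$ (and $\|v\|_2=\infty$ if $v\in\mathcal V\setminus\mathrm{dom}(A)$). Let $0=t_0<t_1<\dots<t_N=T$ be a temporal mesh, $I_n=(t_{n-1},t_n)$, $k_n=t_n-t_{n-1}$, $k=\max_n k_n$, and $w_n^\pm=\lim_{s\to0^\pm}w(t_n+s)$, $[w]_n=w_n^+-w_n^-$. Let $\mathcal V_q$ be the set of pairs $V=(V_1,V_2)$ of functions, left-continuous at the nodes, whose restrictions to each $I_n$ are polynomials in $t$ of degree at most $q$ with coefficients in $\mathcal V$, and let $\mathcal W$ be the set of pairs of functions, left-continuous at the nodes, that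 are smooth on each subinterval up to its end points with values in $\mathrm{dom}(A)$. For $f\in L_1(0,T;H)$ and $u_0,v_0\in\mathcal V$ put $$B(u,v)=\sum_{n=1}^N\int_{I_n}\{a(\dot u_1,v_1)-a(u_2,v_1)+(\dot u_2,v_2)+a(u_1,v_2)\}\,dt+\sum_{n=1}^{N-1}\{a([u_1]_n,v_{1,n}^+)+([u_2]_n,v_{2,n}^+)\}+a(u_{1,0}^+,v_{1,0}^+)+(u_{2,0}^+,v_{2,0}^+),$$ $$L(v)=\sum_{n=1}^N\int_{I_n}(f,v_2)\,dt+a(u_0,v_{1,0}^+)+(v_0,v_{2,0}^+).$$ Let $q\in\{0,1\}$. There is a constant $C>0$, independent of $T$, of the mesh, of $f,u_0,v_0$ and of the functions below, such that the following holds. Let $u_1,u_2\in C([0,T];\mathcal V)$ be $q+1$ times continuously differentiable with values in $\mathcal V$ on each $[t_{n-1},t_n]$, and let $u=(u_1,u_2)$ satisfy $B(u,v)=L(v)$ for all $v\in\mathcal W$ and $(u_1,u_2)(0)=(u_0,v_0)$ (the weak form of the wave equation $\ddot u_1-\Delta u_1=f$, $u_2=\dot u_1$). Let $U=(U_1,U_2)\in\mathcal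 V_q$ satisfy $B(U,V)=L(V)$ for all $V\in\mathcal V_q$ and $U_0^-=(u_0,v_0)$ (the dG($q$) method). Then $e=(e_1,e_2)=U-u$ satisfies $$\sup_{(0,T)}\|e_1\|_1+\sup_{(0,T)}\|e_2\|\le C\Big(k^{q+1}\sup_{(0,T)}\|u_1^{(q+1)}\|_1+k^{q+1}\sup_{(0,T)}\|u_2^{(q+1)}\|+\sum_{n=1}^Nk_n^{q+2}\sup_{I_n}\|u_2^{(q+1)}\|_1+\sum_{n=1}^Nk_n^{q+2}\sup_{I_n}\|u_1^{(q+1)}\|_2\Big),$$ $$\sup_{(0,T)}\|e_1\|\le C\Big(k^{q+1}\sup_{(0,T)}\|u_1^{(q+1)}\|+\sum_{n=1}^Nk_n^{q+2}\sup_{I_n}\|u_2^{(q+1)}\|+\sum_{n=1}^Nk_n^{q+2}\sup_{I_n}\|u_1^{(q+1)}\|_1\Big),$$ where $u_i^{(q+1)}$ is the $(q+1)$-st time derivative, the suprema over $(0,T)$ of $\|u_i^{(q+1)}\|$ and $\|u_i^{(q+1)}\|_1$ are taken off the nodes, and suprema may be $+\infty$. -/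

import Mathlib

open scoped ENNReal NNReal ContDiff

noncomputable section

namespace DGWave

/-! ### The domain and the function spaces -/

/-- `Ω` is a bounded convex polygonal (polyhedral) domain of `ℝ ^ d`: the nonempty interior of the
convex hull of finitely many points (an open interval if `d = 1`). -/
def IsConvexPolygonalDomain {d : ℕ} (Ω : Set (EuclideanSpace ℝ (Fin d))) : Prop :=
  Ω.Nonempty ∧ ∃ S : Finset (EuclideanSpace ℝ (Fin d)),
    Ω = interior (convexHull ℝ (S : Set (EuclideanSpace ℝ (Fin d))))

/-- `φ ∈ C_c^∞(Ω)`. -/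
def IsTestFunction {d : ℕ} (Ω : Set (EuclideanSpace ℝ (Fin d)))
    (φ : EuclideanSpace ℝ (Fin d) → ℝ) : Prop :=
  ContDiff ℝ ∞ φ ∧ HasCompactSupport φ ∧ tsupport φ ⊆ Ω

/-- The space `H = L₂(Ω)`. -/
abbrev L2 {d : ℕ} (Ω : Set (EuclideanSpace ℝ (Fin d))) : Type :=
  MeasureTheory.Lp ℝ 2 (MeasureTheory.volume.restrict Ω)

/-- The space `L₂(Ω; ℝ ^ d)`. -/
abbrev L2Vec {d : ℕ} (Ω : Set (EuclideanSpace ℝ (Fin d))) : Type :=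
  MeasureTheory.Lp (EuclideanSpace ℝ (Fin d)) 2 (MeasureTheory.volume.restrict Ω)

/-- The pairs `(φ, ∇φ)` in `L₂(Ω) × L₂(Ω; ℝ ^ d)`, with `φ ∈ C_c^∞(Ω)`. -/
def testPairs {d : ℕ} (Ω : Set (EuclideanSpace ℝ (Fin d))) :
    Set (WithLp 2 (L2 Ω × L2Vec Ω)) :=
  {p | ∃ φ : EuclideanSpace ℝ (Fin d) → ℝ, IsTestFunction Ω φ ∧
    p.fst =ᵐ[MeasureTheory.volume.restrict Ω] φ ∧
    p.snd =ᵐ[MeasureTheory.volume.restrict Ω] gradient φ}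

/-- `𝒱 = H₀¹(Ω)`, the closure of `C_c^∞(Ω)` in the `H¹`-norm. An element is stored as the pair
`(v, ∇v)` of the function and its weak gradient. -/
def H10 {d : ℕ} (Ω : Set (EuclideanSpace ℝ (Fin d))) :
    Submodule ℝ (WithLp 2 (L2 Ω × L2Vec Ω)) :=
  (Submodule.span ℝ (testPairs Ω)).topologicalClosure

variable {d : ℕ} {Ω : Set (EuclideanSpace ℝ (Fin d))}

/-- `v ∈ H₀¹(Ω)` as an element of `L₂(Ω)`. -/
def fn (v : H10 Ω) : L2 Ω := (v : WithLp 2 (L2 Ω × L2Vec Ω)).fst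

/-- The weak gradient `∇v` of `v ∈ H₀¹(Ω)`. -/
def grad (v : H10 Ω) : L2Vec Ω := (v : WithLp 2 (L2 Ω × L2Vec Ω)).snd

/-- The energy inner product `a(v, w) = (∇v, ∇w)`. -/
def a (v w : H10 Ω) : ℝ := inner ℝ (grad v) (grad w)

/-- The inner product `(v, w)` of `L₂(Ω)`. -/
def ip (v w : H10 Ω) : ℝ := inner ℝ (fn v) (fn w)

/-- `v ∈ dom(A) = H²(Ω) ∩ H₀¹(Ω)` and `A v = -Δ v = w`: the functions `h i j ∈ L₂(Ω)` are the weak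
second derivatives `∂ⱼ∂ᵢ v`, and `w = - ∑ i, h i i`. -/
def IsNegLaplacian (v : H10 Ω) (w : L2 Ω) : Prop :=
  ∃ h : Fin d → Fin d → L2 Ω,
    (∀ i j, ∀ φ : EuclideanSpace ℝ (Fin d) → ℝ, IsTestFunction Ω φ →
      ∫ x in Ω, (grad v x) i * (gradient φ x) j = - ∫ x in Ω, h i j x * φ x) ∧
    w = - ∑ i, h i i

/-- The norm `‖v‖ = ‖v‖₀` of `L₂(Ω)`. -/
def norm0 (v : H10 Ω) : ℝ≥0∞ := ‖fn v‖ₑ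

/-- The norm `‖v‖₁ = ‖∇v‖` of `Ḣ¹ = H₀¹(Ω)`. -/
def norm1 (v : H10 Ω) : ℝ≥0∞ := ‖grad v‖ₑ

/-- The norm `‖v‖₂ = ‖A v‖` of `Ḣ² = dom(A)`; it is `∞` if `v ∉ dom(A)`. -/
def norm2 (v : H10 Ω) : ℝ≥0∞ := ⨅ (w : L2 Ω) (_ : IsNegLaplacian v w), ‖w‖ₑ

/-- `sup_{s ∈ S} ν (g s)`, with value `∞` if it is unbounded. -/
def supNorm (ν : H10 Ω → ℝ≥0∞) (S : Set ℝ) (g : ℝ → H10 Ω) : ℝ≥0∞ := ⨆ s ∈ S, ν (g s)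

/-! ### The temporal mesh -/

/-- A temporal mesh `0 = t₀ < t₁ < ⋯ < t_N = T`, with `N ≥ 1`. -/
structure TimeMesh (T : ℝ) where
  /-- the number of subintervals -/
  N : ℕ
  /-- the nodes; only `t 0, …, t N` are used -/
  t : ℕ → ℝ
  N_pos : 0 < N
  t_zero : t 0 = 0
  t_last : t N = T
  t_lt : ∀ n < N, t n < t (n + 1)

variable {T : ℝ}

/-- The `n`-th open subinterval, counted from `0`. -/
def TimeMesh.I (𝓜 : TimeMesh T) (n : ℕ) : Set ℝ := Set.Ioo (𝓜.t n) (𝓜.t (n + 1))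

/-- The `n`-th step, counted from `0`. -/
def TimeMesh.step (𝓜 : TimeMesh T) (n : ℕ) : ℝ := 𝓜.t (n + 1) - 𝓜.t n

/-- The maximum step-size `k`. -/
def TimeMesh.k (𝓜 : TimeMesh T) : ℝ :=
  (Finset.range 𝓜.N).sup' (Finset.nonempty_range_iff.mpr 𝓜.N_pos.ne') 𝓜.step

/-- `(0, T)` without the nodes, the set on which piecewise smooth functions have derivatives. -/
def TimeMesh.offNodes (𝓜 : TimeMesh T) : Set ℝ := ⋃ n ∈ Finset.range 𝓜.N, 𝓜.I n

/-- One component of a function of `𝒱_q`: on every subinterval a polynomial in time of degree at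
most `q` with coefficients in `𝒱`, left-continuous at the nodes. -/
def IsPiecewisePoly (𝓜 : TimeMesh T) (q : ℕ) (v : ℝ → H10 Ω) : Prop :=
  ∀ n < 𝓜.N, ∃ c : ℕ → H10 Ω, ∀ s ∈ Set.Ioc (𝓜.t n) (𝓜.t (n + 1)),
    v s = ∑ j ∈ Finset.range (q + 1), s ^ j • c j

/-- One component of a function of `𝒲`: piecewise smooth with respect to the mesh with values in
`dom(A)` (for the graph norm), left-continuous at the nodes. -/
def IsPiecewiseSmooth (𝓜 : TimeMesh T) (v : ℝ → H10 Ω) : Prop :=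
  ∀ n < 𝓜.N, ∃ (p : ℝ → H10 Ω) (w : ℝ → L2 Ω),
    ContDiffOn ℝ ∞ p (Set.Icc (𝓜.t n) (𝓜.t (n + 1))) ∧
    ContDiffOn ℝ ∞ w (Set.Icc (𝓜.t n) (𝓜.t (n + 1))) ∧
    (∀ s ∈ Set.Icc (𝓜.t n) (𝓜.t (n + 1)), IsNegLaplacian (p s) (w s)) ∧
    ∀ s ∈ Set.Ioc (𝓜.t n) (𝓜.t (n + 1)), v s = p s

/-- Continuous on `[0, T]` with values in `𝒱`, and `m` times continuously differentiable on every
closed subinterval of the mesh. -/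
def IsPiecewiseC (𝓜 : TimeMesh T) (m : ℕ) (u : ℝ → H10 Ω) : Prop :=
  ContinuousOn u (Set.Icc 0 T) ∧
    ∀ n < 𝓜.N, ContDiffOn ℝ m u (Set.Icc (𝓜.t n) (𝓜.t (n + 1)))

/-! ### The variational problems -/

/-- The jump `[u] = u⁺ - u⁻` at the time `s`. -/
def jump (u : ℝ → H10 Ω) (s : ℝ) : H10 Ω := Function.rightLim u s - Function.leftLim u s

/-- The bilinear form `B((u₁, u₂), (v₁, v₂))`. -/
def B (𝓜 : TimeMesh T) (u₁ u₂ v₁ v₂ : ℝ → H10 Ω) : ℝ :=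
  (∑ n ∈ Finset.range 𝓜.N, ∫ s in (𝓜.t n)..(𝓜.t (n + 1)),
    (a (deriv u₁ s) (v₁ s) - a (u₂ s) (v₁ s) + ip (deriv u₂ s) (v₂ s) + a (u₁ s) (v₂ s))) +
  (∑ n ∈ Finset.Ico 1 𝓜.N,
    (a (jump u₁ (𝓜.t n)) (Function.rightLim v₁ (𝓜.t n)) +
      ip (jump u₂ (𝓜.t n)) (Function.rightLim v₂ (𝓜.t n)))) +
  a (Function.rightLim u₁ 0) (Function.rightLim v₁ 0) +
  ip (Function.rightLim u₂ 0) (Function.rightLim v₂ 0)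

/-- The linear form `L((v₁, v₂))`. -/
def L (𝓜 : TimeMesh T) (f : ℝ → L2 Ω) (u₀ v₀ : H10 Ω) (v₁ v₂ : ℝ → H10 Ω) : ℝ :=
  (∑ n ∈ Finset.range 𝓜.N, ∫ s in (𝓜.t n)..(𝓜.t (n + 1)), inner ℝ (f s) (fn (v₂ s))) +
  a u₀ (Function.rightLim v₁ 0) + ip v₀ (Function.rightLim v₂ 0)

/-- `(u₁, u₂)` solves the continuous problem: `B(u, v) = L(v)` for all `v ∈ 𝒲`, and
`(u₁, u₂)(0) = (u₀, v₀)`. -/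
def IsWaveSolution (𝓜 : TimeMesh T) (f : ℝ → L2 Ω) (u₀ v₀ : H10 Ω) (u₁ u₂ : ℝ → H10 Ω) : Prop :=
  (∀ v₁ v₂ : ℝ → H10 Ω, IsPiecewiseSmooth 𝓜 v₁ → IsPiecewiseSmooth 𝓜 v₂ →
    B 𝓜 u₁ u₂ v₁ v₂ = L 𝓜 f u₀ v₀ v₁ v₂) ∧
  u₁ 0 = u₀ ∧ u₂ 0 = v₀

/-- `(U₁, U₂) ∈ 𝒱_q` solves the dG(`q`) problem: `B(U, V) = L(V)` for all `V ∈ 𝒱_q`, and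
`U₀⁻ = (u₀, v₀)`; by left-continuity `U₀⁻` is the value of `U` at time `0`. -/
def IsDGSolution (𝓜 : TimeMesh T) (q : ℕ) (f : ℝ → L2 Ω) (u₀ v₀ : H10 Ω)
    (U₁ U₂ : ℝ → H10 Ω) : Prop :=
  (IsPiecewisePoly 𝓜 q U₁ ∧ IsPiecewisePoly 𝓜 q U₂) ∧
  (∀ V₁ V₂ : ℝ → H10 Ω, IsPiecewisePoly 𝓜 q V₁ → IsPiecewisePoly 𝓜 q V₂ →
    B 𝓜 U₁ U₂ V₁ V₂ = L 𝓜 f u₀ v₀ V₁ V₂) ∧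
  U₁ 0 = u₀ ∧ U₂ 0 = v₀

end DGWave

end

open DGWave

noncomputable section

namespace DGWave

open MeasureTheory Set Filter Topology

variable {d : ℕ} {Ω : Set (EuclideanSpace ℝ (Fin d))}

/-! ### The space `H₀¹(Ω)` -/

/-! Split the error on each subinterval as e = θ + ρ, where ρ = Πu - u and Πu is the interpolant of
degree q that equals u at the right end point and, if q = 1, has the same mean as u. The scheme is
consistent, so the error satisfies the dG equations with zero data (`error_equations`). Integrated
by parts in time, these contain ρ only through its value at the right end point, its mean against
the constant slope of the test function, and the stiffness terms a(ρ₂, ·) and a(ρ₁, ·). The first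
two vanish by the choice of Π.

Now test with (Sθ₁, Sθ₂) for an operator S such that a(v, Sw) = ⟨T₁v, T₁w⟩ and (v, Sw) = ⟨T₀v, T₀w⟩.
The coupling terms a(θ₂, Sθ₁) and a(θ₁, Sθ₂) cancel by symmetry. What is left on a subinterval
(`energy_step`) says that the energy ‖T₁θ₁‖² + ‖T₀θ₂‖² at the new node, plus that of the jump, is at
most the energy at the old node plus 2M times the size of ρ. Here M bounds θ at both ends, hence
everywhere, since θ is affine in time. Summing with M the global maximum gives M² ≤ 8RM, hence M ≤
8R (`stability`). No Gronwall factor arises, and the constant does not depend on T.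

S = id, with T₁ = ∇ and T₀ the embedding into L₂, gives the energy estimate. S = G, the inverse of
A, with T₁ the embedding and T₀ = ∇G, lowers the order of every norm by one and gives the L₂
estimate for e₁.

Two points need care. The exact solution is tested only with values in dom(A), so its equations are
extended to H₀¹ by density. Also, Πu₁ need not lie in dom(A), so ρ₁ is estimated only through the
scalar functionals a(·, Sc), with which interpolation in time commutes (`abs_interpError_le`). -/

instance : CompleteSpace (H10 Ω) :=
  (Submodule.isClosed_topologicalClosure _).completeSpace_coe

/-- `fn` as a continuous linear map. -/
def fnL (Ω : Set (EuclideanSpace ℝ (Fin d))) : H10 Ω →L[ℝ] L2 Ω :=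
  (WithLp.fstL 2 ℝ (L2 Ω) (L2Vec Ω)).comp (H10 Ω).subtypeL

/-- `grad` as a continuous linear map. -/
def gradL (Ω : Set (EuclideanSpace ℝ (Fin d))) : H10 Ω →L[ℝ] L2Vec Ω :=
  (WithLp.sndL 2 ℝ (L2 Ω) (L2Vec Ω)).comp (H10 Ω).subtypeL

@[simp] lemma fnL_apply (v : H10 Ω) : fnL Ω v = fn v := rfl

@[simp] lemma gradL_apply (v : H10 Ω) : gradL Ω v = grad v := rfl

/-- The energy inner product as a continuous bilinear form. -/
def aL (Ω : Set (EuclideanSpace ℝ (Fin d))) : H10 Ω →L[ℝ] H10 Ω →L[ℝ] ℝ :=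
  (innerSL ℝ).bilinearComp (gradL Ω) (gradL Ω)

/-- The inner product of `L₂(Ω)` as a continuous bilinear form on `H₀¹(Ω)`. -/
def ipL (Ω : Set (EuclideanSpace ℝ (Fin d))) : H10 Ω →L[ℝ] H10 Ω →L[ℝ] ℝ :=
  (innerSL ℝ).bilinearComp (fnL Ω) (fnL Ω)

@[simp] lemma aL_apply (v w : H10 Ω) : aL Ω v w = a v w := rfl

@[simp] lemma ipL_apply (v w : H10 Ω) : ipL Ω v w = ip v w := rfl

lemma norm_sq_eq (v : H10 Ω) : ‖v‖ ^ 2 = ‖fn v‖ ^ 2 + ‖grad v‖ ^ 2 :=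
  WithLp.prod_norm_sq_eq_of_L2 (v : WithLp 2 (L2 Ω × L2Vec Ω))

/-! ### Test functions -/

lemma gradient_apply {d : ℕ} (φ : EuclideanSpace ℝ (Fin d) → ℝ) (x : EuclideanSpace ℝ (Fin d))
    (j : Fin d) : gradient φ x j = fderiv ℝ φ x (EuclideanSpace.single j 1) := by
  have h : inner ℝ (gradient φ x) (EuclideanSpace.single j (1 : ℝ)) =
      fderiv ℝ φ x (EuclideanSpace.single j 1) := by
    simp [gradient]
  rw [← h, EuclideanSpace.inner_single_right]
  simp

lemma IsTestFunction.fderiv_apply {φ : EuclideanSpace ℝ (Fin d) → ℝ} (hφ : IsTestFunction Ω φ)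
    (v : EuclideanSpace ℝ (Fin d)) : IsTestFunction Ω fun x ↦ fderiv ℝ φ x v := by
  obtain ⟨h1, h2, h3⟩ := hφ
  refine ⟨(h1.fderiv_right (m := ∞) (by simp)).clm_apply contDiff_const, ?_, ?_⟩
  · exact h2.fderiv_apply ℝ v
  · exact (tsupport_fderiv_apply_subset ℝ v).trans h3

lemma IsTestFunction.continuous_gradient {φ : EuclideanSpace ℝ (Fin d) → ℝ}
    (hφ : IsTestFunction Ω φ) : Continuous (gradient φ) :=
  (InnerProductSpace.toDual ℝ _).symm.continuous.comp (hφ.1.continuous_fderiv (by simp))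

lemma IsTestFunction.hasCompactSupport_gradient {φ : EuclideanSpace ℝ (Fin d) → ℝ}
    (hφ : IsTestFunction Ω φ) : HasCompactSupport (gradient φ) :=
  (hφ.2.1.fderiv (𝕜 := ℝ)).comp_left (g := (InnerProductSpace.toDual ℝ _).symm) (map_zero _)

lemma IsTestFunction.memLp {φ : EuclideanSpace ℝ (Fin d) → ℝ} (hφ : IsTestFunction Ω φ) :
    MemLp φ 2 (volume.restrict Ω) :=
  (hφ.1.continuous.memLp_of_hasCompactSupport hφ.2.1).restrict Ω

lemma IsTestFunction.memLp_gradient {φ : EuclideanSpace ℝ (Fin d) → ℝ}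
    (hφ : IsTestFunction Ω φ) : MemLp (gradient φ) 2 (volume.restrict Ω) :=
  (hφ.continuous_gradient.memLp_of_hasCompactSupport hφ.hasCompactSupport_gradient).restrict Ω

lemma IsTestFunction.eq_zero {φ : EuclideanSpace ℝ (Fin d) → ℝ} (hφ : IsTestFunction Ω φ)
    {x : EuclideanSpace ℝ (Fin d)} (hx : x ∉ Ω) : φ x = 0 :=
  image_eq_zero_of_notMem_tsupport fun h ↦ hx (hφ.2.2 h)

/-- `v ∈ H₀¹(Ω)` is represented by the test function `φ`. -/
def Represents (φ : EuclideanSpace ℝ (Fin d) → ℝ) (v : H10 Ω) : Prop :=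
  IsTestFunction Ω φ ∧ fn v =ᵐ[volume.restrict Ω] φ ∧
    grad v =ᵐ[volume.restrict Ω] gradient φ

lemma IsTestFunction.exists_represents {φ : EuclideanSpace ℝ (Fin d) → ℝ}
    (hφ : IsTestFunction Ω φ) : ∃ v : H10 Ω, Represents φ v :=
  ⟨⟨WithLp.toLp 2 (hφ.memLp.toLp φ, hφ.memLp_gradient.toLp _),
    subset_closure (Submodule.subset_span
      ⟨φ, hφ, hφ.memLp.coeFn_toLp, hφ.memLp_gradient.coeFn_toLp⟩)⟩,
    hφ, hφ.memLp.coeFn_toLp, hφ.memLp_gradient.coeFn_toLp⟩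

/-- Sums and multiples of test functions are test functions. Hence H₀¹ is the closure of the test
pairs themselves, and density arguments need only a single test function. -/
lemma span_testPairs : (Submodule.span ℝ (testPairs Ω) : Set _) = testPairs Ω := by
  refine subset_antisymm (fun p hp ↦ ?_) Submodule.subset_span
  induction hp using Submodule.span_induction with
  | mem p hp => exact hp
  | zero =>
    refine ⟨0, ⟨contDiff_const, HasCompactSupport.zero, by simp [tsupport]⟩, ?_, ?_⟩
    · exact Lp.coeFn_zero _ _ _
    · refine (Lp.coeFn_zero _ _ _).trans (Eventually.of_forall fun x ↦ ?_)
      simp [gradient]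
  | add p r _ _ hp hr =>
    obtain ⟨φ, ⟨h1, h2, h3⟩, h4, h5⟩ := hp
    obtain ⟨ψ, ⟨k1, k2, k3⟩, k4, k5⟩ := hr
    refine ⟨φ + ψ, ⟨h1.add k1, h2.add k2, (tsupport_add _ _).trans (union_subset h3 k3)⟩, ?_, ?_⟩
    · exact (Lp.coeFn_add p.fst r.fst).trans (h4.add k4)
    · refine (Lp.coeFn_add p.snd r.snd).trans ((h5.add k5).trans (Eventually.of_forall fun x ↦ ?_))
      simp only [gradient, Pi.add_apply]
      rw [fderiv_add (h1.differentiable (by simp) x) (k1.differentiable (by simp) x), map_add]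
  | smul c p _ hp =>
    obtain ⟨φ, ⟨h1, h2, h3⟩, h4, h5⟩ := hp
    refine ⟨c • φ, ⟨contDiff_const.smul h1, h2.smul_left (f := fun _ ↦ c),
      (tsupport_smul_subset_right (fun _ ↦ c) φ).trans h3⟩, ?_, ?_⟩
    · exact (Lp.coeFn_smul c p.fst).trans (h4.const_smul c)
    · refine (Lp.coeFn_smul c p.snd).trans ((h5.const_smul c).trans
        (Eventually.of_forall fun x ↦ ?_))
      simp only [gradient, Pi.smul_apply]
      rw [fderiv_const_smul (h1.differentiable (by simp) x), map_smul]

/-- A closed property of elements of `H₀¹(Ω)` has to be checked only for test functions. -/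
lemma closed_induction {P : H10 Ω → Prop} (hP : IsClosed {v | P v})
    (h : ∀ φ v, Represents φ v → P v) (v : H10 Ω) : P v := by
  have hd : v ∈ closure {w : H10 Ω | (w : WithLp 2 (L2 Ω × L2Vec Ω)) ∈ testPairs Ω} := by
    rw [closure_subtype]
    have hv : (v : WithLp 2 (L2 Ω × L2Vec Ω)) ∈ closure (testPairs Ω) := by
      rw [← span_testPairs]; exact v.2
    refine closure_mono (fun p hp ↦ ?_) hv
    exact ⟨⟨p, subset_closure (Submodule.subset_span hp)⟩, hp, rfl⟩
  refine closure_minimal (fun w hw ↦ ?_) hP hd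
  obtain ⟨φ, hφ⟩ := hw
  exact h φ w hφ

/-- Continuous linear functionals on `H₀¹(Ω)` agree if they agree on test functions. -/
lemma functional_ext {F G : H10 Ω →L[ℝ] ℝ} (h : ∀ φ v, Represents φ v → F v = G v)
    (v : H10 Ω) : F v = G v :=
  closed_induction (P := fun v ↦ F v = G v) (isClosed_eq F.continuous G.continuous) h v

/-! ### The Laplacian -/

/-- Test functions vanish outside Ω, so both integrals extend to the whole space, where integration
by parts has no boundary term. -/
lemma integral_partial_mul {φ ψ : EuclideanSpace ℝ (Fin d) → ℝ} (hφ : IsTestFunction Ω φ)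
    (hψ : IsTestFunction Ω ψ) (v : EuclideanSpace ℝ (Fin d)) :
    ∫ x in Ω, φ x * fderiv ℝ ψ x v = - ∫ x in Ω, fderiv ℝ φ x v * ψ x := by
  have hφ' := hφ.fderiv_apply v
  have hψ' := hψ.fderiv_apply v
  rw [setIntegral_eq_integral_of_forall_compl_eq_zero (fun x hx ↦ by simp [hφ.eq_zero hx]),
    setIntegral_eq_integral_of_forall_compl_eq_zero (fun x hx ↦ by simp [hψ.eq_zero hx])]
  apply integral_mul_fderiv_eq_neg_fderiv_mul_of_integrable
  · exact (hφ'.1.continuous.mul hψ.1.continuous).integrable_of_hasCompactSupport hψ.2.1.mul_left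
  · exact (hφ.1.continuous.mul hψ'.1.continuous).integrable_of_hasCompactSupport hψ'.2.1.mul_left
  · exact (hφ.1.continuous.mul hψ.1.continuous).integrable_of_hasCompactSupport hψ.2.1.mul_left
  · exact fun x _ ↦ hφ.1.differentiable (by simp) x
  · exact fun x _ ↦ hψ.1.differentiable (by simp) x

/-- Classical second derivatives of a test function are weak ones. This makes dom(A) dense in H₀¹.
-/
lemma Represents.exists_isNegLaplacian {φ : EuclideanSpace ℝ (Fin d) → ℝ} {v : H10 Ω}
    (h : Represents φ v) : ∃ w, IsNegLaplacian v w := by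
  obtain ⟨hφ, -, h2⟩ := h
  have hD (i j : Fin d) := (hφ.fderiv_apply (EuclideanSpace.single i 1)).fderiv_apply
    (EuclideanSpace.single j 1)
  refine ⟨_, fun i j ↦ (hD i j).memLp.toLp _, fun i j ψ hψ ↦ ?_, rfl⟩
  have e1 : ∫ x in Ω, grad v x i * gradient ψ x j =
      ∫ x in Ω, fderiv ℝ φ x (EuclideanSpace.single i 1) *
        fderiv ℝ ψ x (EuclideanSpace.single j 1) := by
    refine integral_congr_ae ?_
    filter_upwards [h2] with x hx
    rw [hx, gradient_apply, gradient_apply]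
  rw [e1, integral_partial_mul (hφ.fderiv_apply _) hψ]
  congr 1
  refine integral_congr_ae ?_
  filter_upwards [(hD i j).memLp.coeFn_toLp] with x hx
  rw [hx]

lemma memLp_coord {d : ℕ} {μ : Measure (EuclideanSpace ℝ (Fin d))}
    {g : EuclideanSpace ℝ (Fin d) → EuclideanSpace ℝ (Fin d)} (hg : MemLp g 2 μ) (i : Fin d) :
    MemLp (fun x ↦ g x i) 2 μ :=
  hg.continuousLinearMap_comp (EuclideanSpace.proj (𝕜 := ℝ) i)

/-- Green's formula. -/
lemma IsNegLaplacian.a_eq {v : H10 Ω} {w : L2 Ω} (h : IsNegLaplacian v w) (c : H10 Ω) :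
    a v c = inner ℝ w (fn c) := by
  refine functional_ext (F := aL Ω v) (G := (innerSL ℝ w).comp (fnL Ω)) (fun φ c hc ↦ ?_) c
  obtain ⟨hφ, h1, h2⟩ := hc
  obtain ⟨D, hD, rfl⟩ := h
  have e1 : a v c = ∑ i, ∫ x in Ω, grad v x i * gradient φ x i := by
    rw [a, L2.inner_def, ← integral_finsetSum]
    · refine integral_congr_ae ?_
      filter_upwards [h2] with x hx
      rw [hx, PiLp.inner_apply]
      exact Finset.sum_congr rfl fun i _ ↦ by simp [mul_comm]
    · intro i _
      exact (memLp_coord (Lp.memLp (grad v)) i).integrable_mul (memLp_coord hφ.memLp_gradient i)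
  change a v c = inner ℝ (-∑ i, D i i) (fn c)
  rw [e1, inner_neg_left, sum_inner, ← Finset.sum_neg_distrib]
  refine Finset.sum_congr rfl fun i _ ↦ ?_
  rw [hD i i φ hφ, L2.inner_def]
  congr 1
  refine integral_congr_ae ?_
  filter_upwards [h1] with x hx
  rw [hx]
  simp [mul_comm]

lemma memLp_mul_integrable {v : H10 Ω} {ψ : EuclideanSpace ℝ (Fin d) → ℝ}
    (hψ : IsTestFunction Ω ψ) (i j : Fin d) :
    IntegrableOn (fun x ↦ grad v x i * gradient ψ x j) Ω :=
  (memLp_coord (Lp.memLp (grad v)) i).integrable_mul (memLp_coord hψ.memLp_gradient j)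

lemma IsNegLaplacian.add {v₁ v₂ : H10 Ω} {w₁ w₂ : L2 Ω} (h₁ : IsNegLaplacian v₁ w₁)
    (h₂ : IsNegLaplacian v₂ w₂) : IsNegLaplacian (v₁ + v₂) (w₁ + w₂) := by
  obtain ⟨D, hD, rfl⟩ := h₁
  obtain ⟨E, hE, rfl⟩ := h₂
  refine ⟨D + E, fun i j ψ hψ ↦ ?_, ?_⟩
  · have e1 : ∫ x in Ω, grad (v₁ + v₂) x i * gradient ψ x j =
        ∫ x in Ω, (grad v₁ x i * gradient ψ x j + grad v₂ x i * gradient ψ x j) := by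
      refine integral_congr_ae ?_
      filter_upwards [Lp.coeFn_add (grad v₁) (grad v₂)] with x hx
      have : grad (v₁ + v₂) = grad v₁ + grad v₂ := rfl
      rw [this, hx]
      simp [add_mul]
    have e2 : ∫ x in Ω, (D + E) i j x * ψ x = ∫ x in Ω, (D i j x * ψ x + E i j x * ψ x) := by
      refine integral_congr_ae ?_
      filter_upwards [Lp.coeFn_add (D i j) (E i j)] with x hx
      have : (D + E) i j = D i j + E i j := rfl
      rw [this, hx]
      simp [add_mul]
    rw [e1, e2, integral_add (memLp_mul_integrable hψ i j) (memLp_mul_integrable hψ i j),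
      integral_add (f := fun x ↦ D i j x * ψ x) (g := fun x ↦ E i j x * ψ x)
        ((Lp.memLp _).integrable_mul hψ.memLp) ((Lp.memLp _).integrable_mul hψ.memLp), hD i j ψ hψ, hE i j ψ hψ]
    ring
  · simp [Finset.sum_add_distrib, add_comm]

lemma IsNegLaplacian.smul {v : H10 Ω} {w : L2 Ω} (c : ℝ) (h : IsNegLaplacian v w) :
    IsNegLaplacian (c • v) (c • w) := by
  obtain ⟨D, hD, rfl⟩ := h
  refine ⟨c • D, fun i j ψ hψ ↦ ?_, ?_⟩
  · have e1 : ∫ x in Ω, grad (c • v) x i * gradient ψ x j =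
        ∫ x in Ω, c * (grad v x i * gradient ψ x j) := by
      refine integral_congr_ae ?_
      filter_upwards [Lp.coeFn_smul c (grad v)] with x hx
      have : grad (c • v) = c • grad v := rfl
      rw [this, hx]
      simp [mul_assoc]
    have e2 : ∫ x in Ω, (c • D) i j x * ψ x = ∫ x in Ω, c * (D i j x * ψ x) := by
      refine integral_congr_ae ?_
      filter_upwards [Lp.coeFn_smul c (D i j)] with x hx
      have : (c • D) i j = c • D i j := rfl
      rw [this, hx]
      simp [mul_assoc]
    rw [e1, e2, integral_const_mul, integral_const_mul, hD i j ψ hψ]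
    ring
  · simp [Finset.smul_sum]

lemma isNegLaplacian_zero : IsNegLaplacian (0 : H10 Ω) 0 := by
  obtain ⟨v, hv⟩ := IsTestFunction.exists_represents (Ω := Ω) (φ := 0)
    ⟨contDiff_const, HasCompactSupport.zero, by simp [tsupport]⟩
  obtain ⟨w, hw⟩ := hv.exists_isNegLaplacian
  simpa using hw.smul 0

/-- The energy product is controlled by the graph norm of the first argument. -/
lemma ofReal_abs_a_le (v c : H10 Ω) : ENNReal.ofReal |a v c| ≤ norm2 v * norm0 c := by
  by_cases h0 : norm0 c = 0
  · have hc : fn c = 0 := by simpa [norm0] using h0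
    by_cases hv : ∃ w, IsNegLaplacian v w
    · obtain ⟨w, hw⟩ := hv
      simp [hw.a_eq, hc]
    -- Here the right side is ∞ · 0 = 0, so a(v, c) must vanish. For every test function b, Green's
    -- formula gives (∇b, ∇c) = (Ab, c) = 0; by density this holds for b = c too.
    · have : grad c = 0 := by
        refine inner_self_eq_zero (𝕜 := ℝ).1 ?_
        refine functional_ext (F := aL Ω c) (G := 0) (fun φ b hb ↦ ?_) c
        obtain ⟨w, hw⟩ := hb.exists_isNegLaplacian
        change inner ℝ (grad c) (grad b) = 0
        rw [real_inner_comm]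
        exact (hw.a_eq c).trans (by simp [hc])
      simp [a, this]
  · have h0' : norm0 c ≠ ⊤ := by simp [norm0]
    rw [← ENNReal.div_le_iff h0 h0', norm2]
    refine le_iInf₂ fun w hw ↦ ?_
    rw [ENNReal.div_le_iff h0 h0', hw.a_eq, norm0, ← ofReal_norm, ← ofReal_norm,
      ← ENNReal.ofReal_mul (norm_nonneg _)]
    exact ENNReal.ofReal_le_ofReal (abs_real_inner_le_norm _ _)

/-! ### The Poincaré inequality and the inverse of the Laplacian -/

lemma norm_sq_eq_setIntegral {F : Type*} [NormedAddCommGroup F] [InnerProductSpace ℝ F]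
    {μ : Measure (EuclideanSpace ℝ (Fin d))} (g : Lp F 2 μ) : ‖g‖ ^ 2 = ∫ x, ‖g x‖ ^ 2 ∂μ := by
  rw [← real_inner_self_eq_norm_sq, L2.inner_def]
  simp

lemma IsConvexPolygonalDomain.isBounded (h : IsConvexPolygonalDomain Ω) : Bornology.IsBounded Ω := by
  obtain ⟨-, S, rfl⟩ := h
  exact ((isBounded_convexHull.mpr S.finite_toSet.isBounded)).subset interior_subset

/-- The Poincaré inequality for test functions. -/
lemma IsTestFunction.integral_sq_le {φ : EuclideanSpace ℝ (Fin d) → ℝ} (hφ : IsTestFunction Ω φ)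
    (j : Fin d) {r : ℝ} (hr : ∀ x ∈ Ω, ‖x‖ ≤ r) :
    ∫ x, φ x ^ 2 ≤ 4 * r ^ 2 * ∫ x, ‖gradient φ x‖ ^ 2 := by
  -- The functional ℓ is the coordinate x_j and b its basis vector. Since ∂_j x_j = 1, ∫ φ² = -∫ x_j
  -- ∂_j(φ²) ≤ ½ ∫ φ² + 2r² ∫ |∇φ|², and the first term is absorbed.
  obtain ⟨b, ℓ, hℓb, hℓn, hb⟩ : ∃ (b : EuclideanSpace ℝ (Fin d))
      (ℓ : EuclideanSpace ℝ (Fin d) →L[ℝ] ℝ), ℓ b = 1 ∧ (∀ x, |ℓ x| ≤ ‖x‖) ∧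
        ∀ x, |fderiv ℝ φ x b| ≤ ‖gradient φ x‖ := by
    refine ⟨EuclideanSpace.single j 1, EuclideanSpace.proj j, by simp,
      fun x ↦ PiLp.norm_apply_le x j, fun x ↦ ?_⟩
    rw [← gradient_apply]
    exact PiLp.norm_apply_le (gradient φ x) j
  have hφb := hφ.fderiv_apply b
  have hc := hφ.1.continuous
  have hcb := hφb.1.continuous
  have hsq : Differentiable ℝ fun x ↦ φ x ^ 2 := (hφ.1.differentiable (by simp)).pow 2
  have hsqd (x) : fderiv ℝ (fun x ↦ φ x ^ 2) x b = 2 * φ x * fderiv ℝ φ x b := by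
    rw [fderiv_fun_pow 2 (hφ.1.differentiable (by simp) x)]
    simp
  have hℓ (x) : fderiv ℝ ℓ x b = 1 := by rw [ℓ.fderiv, hℓb]
  have hsc : HasCompactSupport fun x ↦ φ x ^ 2 :=
    hφ.2.1.comp_left (g := fun y ↦ y ^ 2) (by simp)
  have hint1 : Integrable fun x ↦ φ x ^ 2 := by
    refine Continuous.integrable_of_hasCompactSupport (by fun_prop) hsc
  have hint2 : Integrable fun x ↦ ℓ x * (2 * φ x * fderiv ℝ φ x b) :=
    Continuous.integrable_of_hasCompactSupport (by fun_prop)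
      (HasCompactSupport.mul_left (HasCompactSupport.mul_left hφb.2.1))
  have hint3 : Integrable fun x ↦ ‖gradient φ x‖ ^ 2 :=
    Continuous.integrable_of_hasCompactSupport (hφ.continuous_gradient.norm.pow 2)
      (hφ.hasCompactSupport_gradient.comp_left (g := fun y ↦ ‖y‖ ^ 2) (by simp))
  have hparts : ∫ x, ℓ x * (2 * φ x * fderiv ℝ φ x b) = - ∫ x, φ x ^ 2 := by
    have := integral_mul_fderiv_eq_neg_fderiv_mul_of_integrable (μ := volume)
      (f := ℓ) (g := fun x ↦ φ x ^ 2) (v := b) (by simpa only [hℓ, one_mul])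
      (by simpa only [hsqd])
      (Continuous.integrable_of_hasCompactSupport (by fun_prop) (HasCompactSupport.mul_left hsc))
      (fun x _ ↦ ℓ.differentiableAt) (fun x _ ↦ hsq x)
    simpa only [hsqd, hℓ, one_mul] using this
  have hpt (x) : -(ℓ x * (2 * φ x * fderiv ℝ φ x b)) ≤
      1 / 2 * φ x ^ 2 + 2 * r ^ 2 * ‖gradient φ x‖ ^ 2 := by
    by_cases hx : x ∈ Ω
    · have h1 : |ℓ x| ≤ r := (hℓn x).trans (hr x hx)
      have h2 := hb x
      have h3 : (ℓ x * fderiv ℝ φ x b) ^ 2 ≤ r ^ 2 * ‖gradient φ x‖ ^ 2 := by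
        rw [mul_pow, ← sq_abs (ℓ x), ← sq_abs (fderiv ℝ φ x b)]
        gcongr
      nlinarith [sq_nonneg (φ x + 2 * (ℓ x * fderiv ℝ φ x b))]
    · rw [hφ.eq_zero hx]
      simp only [mul_zero, zero_mul, neg_zero]
      positivity
  have hle : ∫ x, φ x ^ 2 ≤ ∫ x, (1 / 2 * φ x ^ 2 + 2 * r ^ 2 * ‖gradient φ x‖ ^ 2) := by
    rw [← neg_neg (∫ x, φ x ^ 2), ← hparts, ← integral_neg]
    exact integral_mono hint2.neg ((hint1.const_mul _).add (hint3.const_mul _)) hpt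
  rw [integral_add (hint1.const_mul _) (hint3.const_mul _), integral_const_mul,
    integral_const_mul] at hle
  linarith

lemma exists_poincare (hd : 0 < d) (hΩ : Bornology.IsBounded Ω) :
    ∃ R : ℝ, 0 < R ∧ ∀ v : H10 Ω, ‖fn v‖ ^ 2 ≤ R * ‖grad v‖ ^ 2 := by
  obtain ⟨r, hr0, hr⟩ := hΩ.exists_pos_norm_le
  refine ⟨4 * r ^ 2, by positivity, fun v ↦ ?_⟩
  refine closed_induction (P := fun v ↦ ‖fn v‖ ^ 2 ≤ 4 * r ^ 2 * ‖grad v‖ ^ 2)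
    (isClosed_le (by exact (fnL Ω).continuous.norm.pow 2)
      (by exact continuous_const.mul ((gradL Ω).continuous.norm.pow 2))) ?_ v
  rintro φ v ⟨hφ, h1, h2⟩
  have e1 : ‖fn v‖ ^ 2 = ∫ x, φ x ^ 2 := by
    rw [norm_sq_eq_setIntegral]
    refine Eq.trans (integral_congr_ae (g := fun x ↦ φ x ^ 2) ?_)
      (setIntegral_eq_integral_of_forall_compl_eq_zero fun x hx ↦ by simp [hφ.eq_zero hx])
    filter_upwards [h1] with x hx
    rw [hx, Real.norm_eq_abs, sq_abs]
  have hg0 : ∀ x, x ∉ Ω → gradient φ x = 0 := fun x hx ↦ by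
    ext i; rw [gradient_apply, (hφ.fderiv_apply _).eq_zero hx]; rfl
  have e2 : ‖grad v‖ ^ 2 = ∫ x, ‖gradient φ x‖ ^ 2 := by
    rw [norm_sq_eq_setIntegral]
    refine Eq.trans (integral_congr_ae (g := fun x ↦ ‖gradient φ x‖ ^ 2) ?_)
      (setIntegral_eq_integral_of_forall_compl_eq_zero fun x hx ↦ by simp [hg0 x hx])
    filter_upwards [h2] with x hx
    rw [hx]
  rw [e1, e2]
  exact hφ.integral_sq_le ⟨0, hd⟩ hr

/-- The solution operator of the Poisson problem, restricted to `H₀¹(Ω)`. -/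
lemma exists_inverse_laplacian (hd : 0 < d) (hΩ : Bornology.IsBounded Ω) :
    ∃ G : H10 Ω →L[ℝ] H10 Ω, ∀ v w, a w (G v) = ip w v := by
  obtain ⟨R, hR, hP⟩ := exists_poincare hd hΩ
  have hco : IsCoercive (aL Ω) := by
    -- The Poincaré inequality bounds the full H¹ norm: ‖v‖² ≤ (R + 1) ‖∇v‖².
    refine ⟨1 / (R + 1), by positivity, fun v ↦ ?_⟩
    have h1 : aL Ω v v = ‖grad v‖ ^ 2 :=
      (aL_apply v v).trans (real_inner_self_eq_norm_sq (grad v))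
    rw [h1, mul_assoc, ← sq, norm_sq_eq, div_mul_eq_mul_div, one_mul, div_le_iff₀ (by positivity)]
    linarith [hP v]
  -- The Riesz representative, in the H¹ inner product, of the functional w ↦ (v, w). Lax–Milgram
  -- then solves a(Gv, ·) = (v, ·).
  let F : H10 Ω →L[ℝ] H10 Ω := (ContinuousLinearMap.adjoint (fnL Ω)).comp (fnL Ω)
  have hF (v w : H10 Ω) : inner ℝ (F v) w = ip v w := by
    rw [ip, ← fnL_apply w, ← ContinuousLinearMap.adjoint_inner_left]
    rfl
  let E := hco.continuousLinearEquivOfBilin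
  refine ⟨E.symm.toContinuousLinearMap.comp F, fun v w ↦ ?_⟩
  have h := hco.continuousLinearEquivOfBilin_apply (E.symm (F v)) w
  rw [show hco.continuousLinearEquivOfBilin = E from rfl, E.apply_symm_apply, hF, aL_apply] at h
  rw [show ip w v = ip v w from real_inner_comm _ _, h]
  exact real_inner_comm _ _

/-! ### Localization to one subinterval -/

variable {T : ℝ}

namespace TimeMesh

variable (𝓜 : TimeMesh T)

lemma t_le {m n : ℕ} (h : m ≤ n) (hn : n ≤ 𝓜.N) : 𝓜.t m ≤ 𝓜.t n := by
  induction n, h using Nat.le_induction with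
  | base => exact le_rfl
  | succ n h ih => exact (ih (by omega)).trans (𝓜.t_lt n (by omega)).le

lemma t_nonneg {n : ℕ} (hn : n ≤ 𝓜.N) : 0 ≤ 𝓜.t n :=
  𝓜.t_zero.ge.trans (𝓜.t_le n.zero_le hn)

lemma t_le_last {n : ℕ} (hn : n ≤ 𝓜.N) : 𝓜.t n ≤ T :=
  (𝓜.t_le hn le_rfl).trans 𝓜.t_last.le

lemma step_pos {n : ℕ} (hn : n < 𝓜.N) : 0 < 𝓜.step n := sub_pos.mpr (𝓜.t_lt n hn)

lemma step_le_k {n : ℕ} (hn : n < 𝓜.N) : 𝓜.step n ≤ 𝓜.k :=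
  Finset.le_sup' 𝓜.step (Finset.mem_range.mpr hn)

lemma notMem_Ioc {m n : ℕ} (hm : m < 𝓜.N) (hn : n < 𝓜.N) (hmn : m ≠ n) {s : ℝ}
    (hs : s ∈ Ioc (𝓜.t m) (𝓜.t (m + 1))) : s ∉ Ioc (𝓜.t n) (𝓜.t (n + 1)) := by
  rintro ⟨h1, h2⟩
  rcases hmn.lt_or_gt with h | h
  · exact absurd (hs.2.trans (𝓜.t_le h hn.le)) h1.not_ge
  · exact absurd (h2.trans (𝓜.t_le h hm.le)) hs.1.not_ge

lemma exists_mem_Ioc {s : ℝ} (hs : s ∈ Ioo 0 T) :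
    ∃ n < 𝓜.N, s ∈ Ioc (𝓜.t n) (𝓜.t (n + 1)) := by
  have h : ∀ m ≤ 𝓜.N, s ≤ 𝓜.t m → ∃ n < m, s ∈ Ioc (𝓜.t n) (𝓜.t (n + 1)) := by
    intro m
    induction m with
    | zero => intro _ h; rw [𝓜.t_zero] at h; exact absurd hs.1 h.not_gt
    | succ m ih =>
      intro hm h
      by_cases h' : s ≤ 𝓜.t m
      · obtain ⟨n, hn, hs⟩ := ih (by omega) h'
        exact ⟨n, by omega, hs⟩
      · exact ⟨m, by omega, not_le.mp h', h⟩
  exact h 𝓜.N le_rfl (hs.2.le.trans 𝓜.t_last.ge)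

/-- The function `p` on the `n`-th subinterval, extended by zero. -/
def localize (n : ℕ) (p : ℝ → H10 Ω) : ℝ → H10 Ω :=
  (Ioc (𝓜.t n) (𝓜.t (n + 1))).indicator p

variable {𝓜}

lemma localize_of_mem {n : ℕ} {p : ℝ → H10 Ω} {s : ℝ} (hs : s ∈ Ioc (𝓜.t n) (𝓜.t (n + 1))) :
    𝓜.localize n p s = p s := indicator_of_mem hs _

lemma localize_of_ne {m n : ℕ} {p : ℝ → H10 Ω} (hm : m < 𝓜.N) (hn : n < 𝓜.N) (hmn : m ≠ n) {s : ℝ}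
    (hs : s ∈ Ioc (𝓜.t m) (𝓜.t (m + 1))) : 𝓜.localize n p s = 0 :=
  indicator_of_notMem (𝓜.notMem_Ioc hm hn hmn hs) _

/-- The right limit at a node of a function that is given by `p` right of the node. -/
lemma rightLim_eq {n : ℕ} (hn : n < 𝓜.N) {v p : ℝ → H10 Ω}
    (hv : ∀ s ∈ Ioc (𝓜.t n) (𝓜.t (n + 1)), v s = p s)
    (hp : ContinuousWithinAt p (Ioi (𝓜.t n)) (𝓜.t n)) :
    Function.rightLim v (𝓜.t n) = p (𝓜.t n) := by
  refine rightLim_eq_of_tendsto (Tendsto.congr' ?_ hp)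
  filter_upwards [Ioc_mem_nhdsGT (𝓜.t_lt n hn)] with s hs
  exact (hv s hs).symm

/-- The left limit at a node of a function that is given by `p` up to the node. -/
lemma leftLim_eq {n : ℕ} (hn : n < 𝓜.N) {v p : ℝ → H10 Ω}
    (hv : ∀ s ∈ Ioc (𝓜.t n) (𝓜.t (n + 1)), v s = p s)
    (hp : ContinuousWithinAt p (Iio (𝓜.t (n + 1))) (𝓜.t (n + 1))) :
    Function.leftLim v (𝓜.t (n + 1)) = v (𝓜.t (n + 1)) := by
  rw [hv _ ⟨𝓜.t_lt n hn, le_rfl⟩]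
  refine leftLim_eq_of_tendsto (Tendsto.congr' ?_ hp)
  filter_upwards [Ioo_mem_nhdsLT (𝓜.t_lt n hn)] with s hs
  exact (hv s ⟨hs.1, hs.2.le⟩).symm

lemma rightLim_localize_self {n : ℕ} (hn : n < 𝓜.N) {p : ℝ → H10 Ω} (hp : Continuous p) :
    Function.rightLim (𝓜.localize n p) (𝓜.t n) = p (𝓜.t n) :=
  rightLim_eq hn (fun _ hs ↦ localize_of_mem hs) hp.continuousWithinAt

lemma rightLim_localize_of_ne {m n : ℕ} (hm : m < 𝓜.N) (hn : n < 𝓜.N) (hmn : m ≠ n)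
    {p : ℝ → H10 Ω} : Function.rightLim (𝓜.localize n p) (𝓜.t m) = 0 :=
  rightLim_eq (p := fun _ ↦ 0) hm (fun _ hs ↦ localize_of_ne hm hn hmn hs)
    continuousWithinAt_const

end TimeMesh

open TimeMesh

lemma fn_zero : fn (0 : H10 Ω) = 0 := rfl

lemma a_zero_right (v : H10 Ω) : a v 0 = 0 := (aL Ω v).map_zero

lemma ip_zero_right (v : H10 Ω) : ip v 0 = 0 := (ipL Ω v).map_zero

lemma a_sub_left (u v w : H10 Ω) : a (u - v) w = a u w - a v w := inner_sub_left _ _ _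

lemma ip_sub_left (u v w : H10 Ω) : ip (u - v) w = ip u w - ip v w := inner_sub_left _ _ _

variable {𝓜 : TimeMesh T}

/-- The variational equation, tested with functions that vanish outside of one subinterval. -/
lemma localized_equation {f : ℝ → L2 Ω} {u₁ u₂ p₁ p₂ : ℝ → H10 Ω} {n : ℕ} (hn : n < 𝓜.N)
    (hp₁ : Continuous p₁) (hp₂ : Continuous p₂)
    (hu₁ : n ≠ 0 → Function.leftLim u₁ (𝓜.t n) = u₁ (𝓜.t n))
    (hu₂ : n ≠ 0 → Function.leftLim u₂ (𝓜.t n) = u₂ (𝓜.t n))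
    (h : B 𝓜 u₁ u₂ (𝓜.localize n p₁) (𝓜.localize n p₂) =
      L 𝓜 f (u₁ 0) (u₂ 0) (𝓜.localize n p₁) (𝓜.localize n p₂)) :
    (∫ s in (𝓜.t n)..(𝓜.t (n + 1)),
      (a (deriv u₁ s) (p₁ s) - a (u₂ s) (p₁ s) + ip (deriv u₂ s) (p₂ s) + a (u₁ s) (p₂ s))) +
      a (Function.rightLim u₁ (𝓜.t n) - u₁ (𝓜.t n)) (p₁ (𝓜.t n)) +
      ip (Function.rightLim u₂ (𝓜.t n) - u₂ (𝓜.t n)) (p₂ (𝓜.t n)) =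
    ∫ s in (𝓜.t n)..(𝓜.t (n + 1)), inner ℝ (f s) (fn (p₂ s)) := by
  have hle (m : ℕ) (hm : m < 𝓜.N) : 𝓜.t m ≤ 𝓜.t (m + 1) := (𝓜.t_lt m hm).le
  rw [B, L, Finset.sum_eq_single_of_mem n (Finset.mem_range.mpr hn),
    Finset.sum_eq_single_of_mem n (Finset.mem_range.mpr hn)] at h
  rotate_left
  · intro m hm hmn
    rw [Finset.mem_range] at hm
    rw [intervalIntegral.integral_of_le (hle m hm)]
    refine setIntegral_eq_zero_of_forall_eq_zero fun s hs ↦ ?_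
    rw [localize_of_ne hm hn hmn hs, fn_zero, inner_zero_right]
  · intro m hm hmn
    rw [Finset.mem_range] at hm
    rw [intervalIntegral.integral_of_le (hle m hm)]
    refine setIntegral_eq_zero_of_forall_eq_zero fun s hs ↦ ?_
    rw [localize_of_ne hm hn hmn hs, localize_of_ne hm hn hmn hs]
    simp [a_zero_right, ip_zero_right]
  have e1 : ∫ s in (𝓜.t n)..(𝓜.t (n + 1)), (a (deriv u₁ s) (𝓜.localize n p₁ s) -
        a (u₂ s) (𝓜.localize n p₁ s) + ip (deriv u₂ s) (𝓜.localize n p₂ s) +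
        a (u₁ s) (𝓜.localize n p₂ s)) =
      ∫ s in (𝓜.t n)..(𝓜.t (n + 1)), (a (deriv u₁ s) (p₁ s) - a (u₂ s) (p₁ s) +
        ip (deriv u₂ s) (p₂ s) + a (u₁ s) (p₂ s)) := by
    rw [intervalIntegral.integral_of_le (hle n hn), intervalIntegral.integral_of_le (hle n hn)]
    refine setIntegral_congr_fun measurableSet_Ioc fun s hs ↦ ?_
    simp only [localize_of_mem hs]
  have e2 : ∫ s in (𝓜.t n)..(𝓜.t (n + 1)), inner ℝ (f s) (fn (𝓜.localize n p₂ s)) =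
      ∫ s in (𝓜.t n)..(𝓜.t (n + 1)), inner ℝ (f s) (fn (p₂ s)) := by
    rw [intervalIntegral.integral_of_le (hle n hn), intervalIntegral.integral_of_le (hle n hn)]
    refine setIntegral_congr_fun measurableSet_Ioc fun s hs ↦ ?_
    simp only [localize_of_mem hs]
  rw [e1, e2] at h
  have hother (m : ℕ) (hm : m < 𝓜.N) (hmn : m ≠ n) (p : ℝ → H10 Ω) :=
    rightLim_localize_of_ne (p := p) hm hn hmn
  -- On the first subinterval the initial terms of B minus those of L play the role of the jump; the
  -- value at time 0 stands for the left limit.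
  rcases eq_or_ne n 0 with rfl | h0
  · rw [Finset.sum_eq_zero] at h
    rotate_left
    · intro m hm
      rw [Finset.mem_Ico] at hm
      rw [hother m hm.2 (by omega), hother m hm.2 (by omega), a_zero_right, ip_zero_right, add_zero]
    have k1 := rightLim_localize_self hn hp₁
    have k2 := rightLim_localize_self hn hp₂
    rw [𝓜.t_zero] at k1 k2 h ⊢
    rw [k1, k2] at h
    rw [a_sub_left, ip_sub_left]
    linarith
  · rw [Finset.sum_eq_single_of_mem n (Finset.mem_Ico.mpr ⟨by omega, hn⟩)] at h
    rotate_left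
    · intro m hm hmn
      rw [Finset.mem_Ico] at hm
      rw [hother m hm.2 hmn, hother m hm.2 hmn, a_zero_right, ip_zero_right, add_zero]
    have k1 := hother 0 𝓜.N_pos h0.symm p₁
    have k2 := hother 0 𝓜.N_pos h0.symm p₂
    rw [𝓜.t_zero] at k1 k2
    rw [k1, k2, rightLim_localize_self hn hp₁, rightLim_localize_self hn hp₂, jump, jump,
      hu₁ h0, hu₂ h0] at h
    simp only [a_zero_right, ip_zero_right, add_zero] at h
    linarith

/-! ### Affine functions and test functions on one subinterval -/

/-- The slopes of the polynomials of degree at most `q`, for `q ≤ 1`. -/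
def slopes (Ω : Set (EuclideanSpace ℝ (Fin d))) (q : ℕ) : Submodule ℝ (H10 Ω) :=
  if q = 0 then ⊥ else ⊤

/-- The affine function with value `z` at `b` and slope `w`. -/
def affine {V : Type*} [AddCommGroup V] [Module ℝ V] (b : ℝ) (z w : V) (s : ℝ) : V :=
  z + (s - b) • w

lemma continuous_affine {V : Type*} [NormedAddCommGroup V] [NormedSpace ℝ V] (b : ℝ) (z w : V) :
    Continuous (affine b z w) := by
  unfold affine; fun_prop

lemma hasDerivAt_affine {V : Type*} [NormedAddCommGroup V] [NormedSpace ℝ V] (b : ℝ) (z w : V)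
    (s : ℝ) : HasDerivAt (affine b z w) w s := by
  have := (((hasDerivAt_id s).sub_const b).smul_const w).const_add z
  rw [one_smul] at this
  exact this

lemma IsPiecewisePoly.exists_affine {q : ℕ} (hq : q = 0 ∨ q = 1) {v : ℝ → H10 Ω}
    (hv : IsPiecewisePoly 𝓜 q v) {n : ℕ} (hn : n < 𝓜.N) :
    ∃ z, ∃ w ∈ slopes Ω q, ∀ s ∈ Ioc (𝓜.t n) (𝓜.t (n + 1)),
      v s = affine (𝓜.t (n + 1)) z w s := by
  obtain ⟨c, hc⟩ := hv n hn
  rcases hq with rfl | rfl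
  · exact ⟨c 0, 0, zero_mem _, fun s hs ↦ by rw [hc s hs]; simp [affine]⟩
  · refine ⟨c 0 + 𝓜.t (n + 1) • c 1, c 1, by simp [slopes], fun s hs ↦ ?_⟩
    rw [hc s hs, affine, sub_smul]
    simp [Finset.sum_range_succ]

lemma isPiecewisePoly_localize {q : ℕ} (hq : q = 0 ∨ q = 1) {n : ℕ} (hn : n < 𝓜.N) {z w : H10 Ω}
    (hw : w ∈ slopes Ω q) (b : ℝ) : IsPiecewisePoly 𝓜 q (𝓜.localize n (affine b z w)) := by
  intro m hm
  rcases eq_or_ne m n with rfl | hmn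
  · rcases hq with rfl | rfl
    · obtain rfl : w = 0 := by simpa [slopes] using hw
      exact ⟨fun _ ↦ z, fun s hs ↦ by rw [localize_of_mem hs]; simp [affine]⟩
    · refine ⟨fun j ↦ if j = 0 then z - b • w else w, fun s hs ↦ ?_⟩
      rw [localize_of_mem hs, affine, sub_smul]
      simp [Finset.sum_range_succ]
      abel
  · exact ⟨fun _ ↦ 0, fun s hs ↦ by rw [localize_of_ne hm hn hmn hs]; simp⟩

lemma isPiecewiseSmooth_localize {n : ℕ} (hn : n < 𝓜.N) {v : H10 Ω} {w : L2 Ω}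
    (hv : IsNegLaplacian v w) {σ : ℝ → ℝ} (hσ : ContDiff ℝ ∞ σ) :
    IsPiecewiseSmooth 𝓜 (𝓜.localize n fun s ↦ σ s • v) := by
  intro m hm
  rcases eq_or_ne m n with rfl | hmn
  · exact ⟨fun s ↦ σ s • v, fun s ↦ σ s • w, (hσ.smul contDiff_const).contDiffOn,
      (hσ.smul contDiff_const).contDiffOn, fun s _ ↦ hv.smul _, fun s hs ↦ localize_of_mem hs⟩
  · exact ⟨fun _ ↦ 0, fun _ ↦ 0, contDiffOn_const, contDiffOn_const,
      fun _ _ ↦ isNegLaplacian_zero, fun s hs ↦ localize_of_ne hm hn hmn hs⟩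

lemma isPiecewiseSmooth_zero : IsPiecewiseSmooth 𝓜 (fun _ ↦ (0 : H10 Ω)) :=
  fun _ _ ↦ ⟨fun _ ↦ 0, fun _ ↦ 0, contDiffOn_const, contDiffOn_const,
    fun _ _ ↦ isNegLaplacian_zero, fun _ _ ↦ rfl⟩

lemma localize_zero (n : ℕ) : 𝓜.localize n (fun _ ↦ (0 : H10 Ω)) = fun _ ↦ 0 :=
  indicator_zero _ _

/-! ### Piecewise regular functions -/

section Regular

variable {V : Type*} [NormedAddCommGroup V] [NormedSpace ℝ V] {u : ℝ → V} {α β : ℝ}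

lemma hasDerivAt_of_contDiffOn_Icc {m : ℕ} (hu : ContDiffOn ℝ (m + 1 : ℕ) u (Icc α β))
    {s : ℝ} (hs : s ∈ Ioo α β) : HasDerivAt u (deriv u s) s :=
  ((hu.contDiffAt (Icc_mem_nhds hs.1 hs.2)).differentiableAt (by simp)).hasDerivAt

/-- At a node the two one-sided derivatives may differ, so `deriv u` can be a default value there.
It agrees with the continuous one-sided derivative on the open interval, which is enough for
integrals. -/
lemma intervalIntegrable_deriv {m : ℕ} (hαβ : α < β) (hu : ContDiffOn ℝ (m + 1 : ℕ) u (Icc α β)) :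
    IntervalIntegrable (deriv u) volume α β := by
  have h1 : ContinuousOn (derivWithin u (Icc α β)) (Icc α β) :=
    hu.continuousOn_derivWithin (uniqueDiffOn_Icc hαβ) (by simp)
  refine (h1.intervalIntegrable_of_Icc hαβ.le).congr_uIoo fun s hs ↦ ?_
  rw [uIoo_of_le hαβ.le] at hs
  exact derivWithin_of_mem_nhds (Icc_mem_nhds hs.1 hs.2)

end Regular

lemma IsPiecewiseC.rightLim_eq {m n : ℕ} {u : ℝ → H10 Ω} (hu : IsPiecewiseC 𝓜 m u) (hn : n < 𝓜.N) :
    Function.rightLim u (𝓜.t n) = u (𝓜.t n) :=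
  TimeMesh.rightLim_eq hn (fun _ _ ↦ rfl) <|
    ((hu.2 n hn).continuousOn _ (left_mem_Icc.mpr (𝓜.t_lt n hn).le)).mono_of_mem_nhdsWithin
      (mem_of_superset (Ioc_mem_nhdsGT (𝓜.t_lt n hn)) Ioc_subset_Icc_self)

lemma IsPiecewiseC.leftLim_eq {m n : ℕ} {u : ℝ → H10 Ω} (hu : IsPiecewiseC 𝓜 m u) (hn : n < 𝓜.N)
    (h0 : n ≠ 0) : Function.leftLim u (𝓜.t n) = u (𝓜.t n) := by
  obtain ⟨n, rfl⟩ := Nat.exists_eq_succ_of_ne_zero h0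
  have hlt := 𝓜.t_lt n (by omega)
  exact TimeMesh.leftLim_eq (by omega) (fun _ _ ↦ rfl) <|
    ((hu.2 n (by omega)).continuousOn _ (right_mem_Icc.mpr hlt.le)).mono_of_mem_nhdsWithin
      (mem_of_superset (Ioo_mem_nhdsLT hlt) Ioo_subset_Icc_self)

lemma intervalIntegrable_of_integrableOn {f : ℝ → L2 Ω} (hf : IntegrableOn f (Ioo 0 T)) {n : ℕ}
    (hn : n < 𝓜.N) : IntervalIntegrable f volume (𝓜.t n) (𝓜.t (n + 1)) := by
  rw [intervalIntegrable_iff_integrableOn_Ioo_of_le (𝓜.t_lt n hn).le]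
  exact hf.mono_set (Ioo_subset_Ioo (𝓜.t_nonneg hn.le) (𝓜.t_le_last hn))

/-! ### The equations on one subinterval -/

lemma intervalIntegral_clm {V W : Type*} [NormedAddCommGroup V] [NormedSpace ℝ V] [CompleteSpace V]
    [NormedAddCommGroup W] [NormedSpace ℝ W] [CompleteSpace W] (F : V →L[ℝ] W)
    {g : ℝ → V} {α β : ℝ} (hg : IntervalIntegrable g volume α β) :
    ∫ s in α..β, F (g s) = F (∫ s in α..β, g s) :=
  F.intervalIntegral_comp_comm hg

lemma intervalIntegrable_clm {V W : Type*} [NormedAddCommGroup V] [NormedSpace ℝ V]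
    [NormedAddCommGroup W] [NormedSpace ℝ W] (F : V →L[ℝ] W)
    {g : ℝ → V} {α β : ℝ} (hg : IntervalIntegrable g volume α β) :
    IntervalIntegrable (fun s ↦ F (g s)) volume α β :=
  ⟨F.integrable_comp hg.1, F.integrable_comp hg.2⟩

lemma aL_flip_apply (v w : H10 Ω) : (aL Ω).flip w v = a v w := rfl

section Wave

variable {f : ℝ → L2 Ω} {u₀ v₀ : H10 Ω} {u₁ u₂ : ℝ → H10 Ω} {q n : ℕ}

/-- For a test function c, the product σ(s)c on one subinterval is an admissible test function, and
the jumps of the continuous solution vanish. The integral is a continuous functional of c in H₀¹, so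
density gives the rest. -/
lemma IsWaveSolution.integral_fst (h : IsWaveSolution 𝓜 f u₀ v₀ u₁ u₂)
    (hu₁ : IsPiecewiseC 𝓜 (q + 1) u₁) (hu₂ : IsPiecewiseC 𝓜 (q + 1) u₂) (hn : n < 𝓜.N)
    {σ : ℝ → ℝ} (hσ : ContDiff ℝ ∞ σ) (c : H10 Ω) :
    ∫ s in (𝓜.t n)..(𝓜.t (n + 1)), σ s * (a (deriv u₁ s) c - a (u₂ s) c) = 0 := by
  obtain ⟨heq, rfl, rfl⟩ := h
  have hle := (𝓜.t_lt n hn).le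
  have hint : IntervalIntegrable (fun s ↦ σ s • (deriv u₁ s - u₂ s)) volume (𝓜.t n)
      (𝓜.t (n + 1)) :=
    ((intervalIntegrable_deriv (𝓜.t_lt n hn) (hu₁.2 n hn)).sub
      ((hu₂.2 n hn).continuousOn.intervalIntegrable_of_Icc hle)).continuousOn_smul
      hσ.continuous.continuousOn
  have key (c : H10 Ω) : ∫ s in (𝓜.t n)..(𝓜.t (n + 1)), σ s * (a (deriv u₁ s) c - a (u₂ s) c) =
      aL Ω (∫ s in (𝓜.t n)..(𝓜.t (n + 1)), σ s • (deriv u₁ s - u₂ s)) c := by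
    rw [aL_apply, ← aL_flip_apply, ← intervalIntegral_clm _ hint]
    simp
  rw [key]
  refine functional_ext (G := 0) (fun φ c hc ↦ ?_) c
  rw [← key]
  obtain ⟨w, hw⟩ := hc.exists_isNegLaplacian
  have h0 := localized_equation hn (p₁ := fun s ↦ σ s • c) (p₂ := fun _ ↦ 0)
    (hσ.continuous.smul continuous_const) continuous_const (hu₁.leftLim_eq hn)
    (hu₂.leftLim_eq hn) (heq _ _ (isPiecewiseSmooth_localize hn hw hσ)
      (by rw [localize_zero]; exact isPiecewiseSmooth_zero))
  rw [hu₁.rightLim_eq hn, hu₂.rightLim_eq hn] at h0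
  simp only [← aL_apply, ← ipL_apply, fn_zero, inner_zero_right, map_zero, sub_self, map_smul,
    smul_eq_mul, add_zero, zero_apply, intervalIntegral.integral_zero,
    ← mul_sub, mul_zero] at h0
  simpa using h0

/-- The same density argument for the second component, where the load f also enters. -/
lemma IsWaveSolution.integral_snd (h : IsWaveSolution 𝓜 f u₀ v₀ u₁ u₂)
    (hf : IntegrableOn f (Ioo 0 T))
    (hu₁ : IsPiecewiseC 𝓜 (q + 1) u₁) (hu₂ : IsPiecewiseC 𝓜 (q + 1) u₂) (hn : n < 𝓜.N)
    {σ : ℝ → ℝ} (hσ : ContDiff ℝ ∞ σ) (c : H10 Ω) :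
    ∫ s in (𝓜.t n)..(𝓜.t (n + 1)), σ s * (ip (deriv u₂ s) c + a (u₁ s) c - inner ℝ (f s) (fn c)) =
      0 := by
  obtain ⟨heq, rfl, rfl⟩ := h
  have hle := (𝓜.t_lt n hn).le
  have hσc := hσ.continuous.continuousOn (s := uIcc (𝓜.t n) (𝓜.t (n + 1)))
  have hint1 : IntervalIntegrable (fun s ↦ σ s • deriv u₂ s) volume (𝓜.t n) (𝓜.t (n + 1)) :=
    (intervalIntegrable_deriv (𝓜.t_lt n hn) (hu₂.2 n hn)).continuousOn_smul hσc
  have hint2 : IntervalIntegrable (fun s ↦ σ s • u₁ s) volume (𝓜.t n) (𝓜.t (n + 1)) :=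
    ((hu₁.2 n hn).continuousOn.intervalIntegrable_of_Icc hle).continuousOn_smul hσc
  have hint3 : IntervalIntegrable (fun s ↦ σ s • f s) volume (𝓜.t n) (𝓜.t (n + 1)) :=
    (intervalIntegrable_of_integrableOn hf hn).continuousOn_smul hσc
  have e1 (c : H10 Ω) (s : ℝ) : σ s * ip (deriv u₂ s) c = (ipL Ω).flip c (σ s • deriv u₂ s) := by
    simp
  have e2 (c : H10 Ω) (s : ℝ) : σ s * a (u₁ s) c = (aL Ω).flip c (σ s • u₁ s) := by
    simp
  have e3 (c : H10 Ω) (s : ℝ) : σ s * inner ℝ (f s) (fn c) = innerSL ℝ (fn c) (σ s • f s) := by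
    rw [innerSL_apply_apply, inner_smul_right, real_inner_comm]
  have i1 (c : H10 Ω) : IntervalIntegrable (fun s ↦ σ s * ip (deriv u₂ s) c) volume (𝓜.t n)
      (𝓜.t (n + 1)) := by
    simp only [e1]
    exact intervalIntegrable_clm ((ipL Ω).flip c) hint1
  have i2 (c : H10 Ω) : IntervalIntegrable (fun s ↦ σ s * a (u₁ s) c) volume (𝓜.t n)
      (𝓜.t (n + 1)) := by
    simp only [e2]
    exact intervalIntegrable_clm ((aL Ω).flip c) hint2
  have i3 (c : H10 Ω) : IntervalIntegrable (fun s ↦ σ s * inner ℝ (f s) (fn c)) volume (𝓜.t n)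
      (𝓜.t (n + 1)) := by
    simp only [e3]
    exact intervalIntegrable_clm (innerSL ℝ (fn c)) hint3
  have key (c : H10 Ω) : ∫ s in (𝓜.t n)..(𝓜.t (n + 1)), σ s *
        (ip (deriv u₂ s) c + a (u₁ s) c - inner ℝ (f s) (fn c)) =
      (ipL Ω (∫ s in (𝓜.t n)..(𝓜.t (n + 1)), σ s • deriv u₂ s) +
        aL Ω (∫ s in (𝓜.t n)..(𝓜.t (n + 1)), σ s • u₁ s) -
        (innerSL ℝ (∫ s in (𝓜.t n)..(𝓜.t (n + 1)), σ s • f s)).comp (fnL Ω)) c := by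
    simp only [mul_sub, mul_add]
    rw [intervalIntegral.integral_sub ((i1 c).add (i2 c)) (i3 c),
      intervalIntegral.integral_add (i1 c) (i2 c)]
    simp only [e1, e2, e3]
    rw [intervalIntegral_clm _ hint1, intervalIntegral_clm _ hint2, intervalIntegral_clm _ hint3]
    simp [real_inner_comm]
  rw [key]
  refine functional_ext (G := 0) (fun φ c hc ↦ ?_) c
  rw [← key]
  obtain ⟨w, hw⟩ := hc.exists_isNegLaplacian
  have h0 := localized_equation hn (p₁ := fun _ ↦ 0) (p₂ := fun s ↦ σ s • c)
    continuous_const (hσ.continuous.smul continuous_const) (hu₁.leftLim_eq hn)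
    (hu₂.leftLim_eq hn) (heq _ _ (by rw [localize_zero]; exact isPiecewiseSmooth_zero)
      (isPiecewiseSmooth_localize hn hw hσ))
  have e4 (s : ℝ) : inner ℝ (f s) (fn (σ s • c)) = σ s * inner ℝ (f s) (fn c) :=
    inner_smul_right _ _ _
  rw [hu₁.rightLim_eq hn, hu₂.rightLim_eq hn] at h0
  simp only [e4] at h0
  simp only [mul_sub, mul_add]
  rw [intervalIntegral.integral_sub ((i1 c).add (i2 c)) (i3 c), ← h0]
  simp only [← aL_apply, ← ipL_apply, map_zero, sub_self, map_smul, zero_add,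
    smul_eq_mul, add_zero, zero_apply, mul_zero]

end Wave

/-! ### The error equations -/

section Abstract

variable {V W : Type*} [NormedAddCommGroup V] [NormedSpace ℝ V] [NormedAddCommGroup W]
  [NormedSpace ℝ W] {α b : ℝ}

lemma intervalIntegrable_bilin (β : V →L[ℝ] W →L[ℝ] ℝ) {g : ℝ → V}
    (hg : IntervalIntegrable g volume α b) (c : ℝ) (z w : W) :
    IntervalIntegrable (fun s ↦ β (g s) (affine c z w s)) volume α b := by
  have h1 := intervalIntegrable_clm (β.flip z) hg
  have h2 := (intervalIntegrable_clm (β.flip w) hg).continuousOn_smul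
    (f := fun s ↦ s - c) (by fun_prop)
  refine (h1.add h2).congr fun s _ ↦ ?_
  simp [affine]

/-- An affine test function combines the weights σ = 1 and σ = s - c with fixed vectors. -/
lemma integral_affine_eq_zero {F : ℝ → W →L[ℝ] ℝ}
    (hF : ∀ c, IntervalIntegrable (fun s ↦ F s c) volume α b)
    (h : ∀ σ : ℝ → ℝ, ContDiff ℝ ∞ σ → ∀ c, ∫ s in α..b, σ s * F s c = 0) (c : ℝ) (z w : W) :
    ∫ s in α..b, F s (affine c z w s) = 0 := by
  have h1 := h (fun _ ↦ 1) contDiff_const z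
  have h2 := h (fun s ↦ s - c) (by fun_prop) w
  have i2 : IntervalIntegrable (fun s ↦ (s - c) * F s w) volume α b :=
    (hF w).continuousOn_smul (f := fun s ↦ s - c) (by fun_prop)
  simp only [one_mul] at h1
  simp only [affine, map_add, map_smul, smul_eq_mul]
  rw [intervalIntegral.integral_add (hF z) i2, h1, h2, add_zero]

lemma integral_by_parts_affine (hα : α ≤ b) (β : V →L[ℝ] W →L[ℝ] ℝ) {e e' : ℝ → V}
    (he : ContinuousOn e (Icc α b)) (hd : ∀ s ∈ Ioo α b, HasDerivAt e (e' s) s)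
    (hi : IntervalIntegrable e' volume α b) (z w : W) :
    ∫ s in α..b, β (e' s) (affine b z w s) =
      β (e b) z - β (e α) (affine b z w α) - ∫ s in α..b, β (e s) w := by
  have i1 := intervalIntegrable_bilin β hi b z w
  have i2 := intervalIntegrable_clm (β.flip w) (he.intervalIntegrable_of_Icc hα)
  simp only [ContinuousLinearMap.flip_apply] at i2
  have h := intervalIntegral.integral_eq_sub_of_hasDerivAt_of_le hα
    (f := fun s ↦ β (e s) (affine b z w s))
    (f' := fun s ↦ β (e' s) (affine b z w s) + β (e s) w)
    ((β.continuous.comp_continuousOn he).clm_apply (continuous_affine b z w).continuousOn)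
    (fun s hs ↦ by
      have h1 := β.hasFDerivAt.comp_hasDerivAt s (hd s hs)
      have h2 := h1.clm_apply (hasDerivAt_affine b z w s)
      exact h2) (i1.add i2)
  rw [intervalIntegral.integral_add i1 i2] at h
  have hb : affine b z w b = z := by simp [affine]
  rw [hb] at h
  linarith

/-- The common right side c cancels in the difference of the discrete and the exact equation.
Integration by parts puts the derivative on the test function, and its boundary term at α absorbs
the right limit in the jump, so that only the incoming error x - u(α) remains there. -/
lemma error_equation (hα : α < b) (β : V →L[ℝ] V →L[ℝ] ℝ) {u : ℝ → V} {m : ℕ}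
    (hu : ContDiffOn ℝ (m + 1 : ℕ) u (Icc α b)) {g₁ g₂ : ℝ → ℝ}
    (hg₁ : IntervalIntegrable g₁ volume α b) (hg₂ : IntervalIntegrable g₂ volume α b)
    {ζ η x z w : V} {c : ℝ}
    (h₁ : (∫ s in α..b, (β η (affine b z w s) - g₁ s)) +
      β (affine b ζ η α - x) (affine b z w α) = c)
    (h₂ : ∫ s in α..b, (β (deriv u s) (affine b z w s) - g₂ s) = c) :
    β (ζ - u b) z - β (x - u α) (affine b z w α) - (∫ s in α..b, β (affine b ζ η s - u s) w) =
      ∫ s in α..b, (g₁ s - g₂ s) := by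
  have hi := intervalIntegrable_deriv hα hu
  have hp := integral_by_parts_affine hα.le β (e := fun s ↦ affine b ζ η s - u s)
    (e' := fun s ↦ η - deriv u s) ((continuous_affine b ζ η).continuousOn.sub hu.continuousOn)
    (fun s hs ↦ (hasDerivAt_affine b ζ η s).sub (hasDerivAt_of_contDiffOn_Icc hu hs))
    (intervalIntegrable_const.sub hi) z w
  have i1 := intervalIntegrable_bilin β (intervalIntegrable_const (c := η) (μ := volume)
    (a := α) (b := b)) b z w
  have i2 := intervalIntegrable_bilin β hi b z w
  have hb : affine b ζ η b = ζ := by simp [affine]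
  simp only [map_sub, sub_apply, hb] at hp ⊢ h₁
  rw [intervalIntegral.integral_sub i1 hg₁] at h₁
  rw [intervalIntegral.integral_sub i2 hg₂] at h₂
  rw [intervalIntegral.integral_sub i1 i2] at hp
  rw [intervalIntegral.integral_sub hg₁ hg₂]
  linarith

end Abstract

/-! ### Galerkin orthogonality on one subinterval -/

section Galerkin

variable {f : ℝ → L2 Ω} {u₀ v₀ : H10 Ω} {u₁ u₂ U₁ U₂ : ℝ → H10 Ω} {q n : ℕ}

lemma IsWaveSolution.integral_fst_affine (h : IsWaveSolution 𝓜 f u₀ v₀ u₁ u₂)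
    (hu₁ : IsPiecewiseC 𝓜 (q + 1) u₁) (hu₂ : IsPiecewiseC 𝓜 (q + 1) u₂) (hn : n < 𝓜.N)
    (b : ℝ) (z w : H10 Ω) :
    ∫ s in (𝓜.t n)..(𝓜.t (n + 1)),
      (aL Ω (deriv u₁ s) (affine b z w s) - aL Ω (u₂ s) (affine b z w s)) = 0 := by
  have hle := (𝓜.t_lt n hn).le
  have i1 (c : H10 Ω) := intervalIntegrable_clm ((aL Ω).flip c)
    (intervalIntegrable_deriv (𝓜.t_lt n hn) (hu₁.2 n hn))
  have i2 (c : H10 Ω) := intervalIntegrable_clm ((aL Ω).flip c)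
    ((hu₂.2 n hn).continuousOn.intervalIntegrable_of_Icc (μ := volume) hle)
  simp only [ContinuousLinearMap.flip_apply] at i1 i2
  have := integral_affine_eq_zero (F := fun s ↦ aL Ω (deriv u₁ s) - aL Ω (u₂ s))
    (fun c ↦ by simpa only [sub_apply] using (i1 c).sub (i2 c))
    (fun σ hσ c ↦ by
      simpa only [sub_apply, aL_apply] using h.integral_fst hu₁ hu₂ hn hσ c) b z w
  simpa only [sub_apply] using this

lemma IsWaveSolution.integral_snd_affine (h : IsWaveSolution 𝓜 f u₀ v₀ u₁ u₂)
    (hf : IntegrableOn f (Ioo 0 T))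
    (hu₁ : IsPiecewiseC 𝓜 (q + 1) u₁) (hu₂ : IsPiecewiseC 𝓜 (q + 1) u₂) (hn : n < 𝓜.N)
    (b : ℝ) (z w : H10 Ω) :
    ∫ s in (𝓜.t n)..(𝓜.t (n + 1)),
      (ipL Ω (deriv u₂ s) (affine b z w s) - -(aL Ω (u₁ s) (affine b z w s))) =
    ∫ s in (𝓜.t n)..(𝓜.t (n + 1)), inner ℝ (f s) (fn (affine b z w s)) := by
  have hle := (𝓜.t_lt n hn).le
  have i1 := intervalIntegrable_deriv (𝓜.t_lt n hn) (hu₂.2 n hn)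
  have i2 := (hu₁.2 n hn).continuousOn.intervalIntegrable_of_Icc (μ := volume) hle
  have i3 := intervalIntegrable_of_integrableOn hf hn
  let γ : L2 Ω →L[ℝ] H10 Ω →L[ℝ] ℝ :=
    (innerSL ℝ).bilinearComp (ContinuousLinearMap.id ℝ _) (fnL Ω)
  have hγ (x : L2 Ω) (c : H10 Ω) : γ x c = inner ℝ x (fn c) := rfl
  have k1 (c : H10 Ω) := intervalIntegrable_clm ((ipL Ω).flip c) i1
  have k2 (c : H10 Ω) := intervalIntegrable_clm ((aL Ω).flip c) i2
  have k3 (c : H10 Ω) := intervalIntegrable_clm (γ.flip c) i3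
  simp only [ContinuousLinearMap.flip_apply] at k1 k2 k3
  have := integral_affine_eq_zero (F := fun s ↦ ipL Ω (deriv u₂ s) + aL Ω (u₁ s) - γ (f s))
    (fun c ↦ by simpa only [sub_apply, add_apply] using ((k1 c).add (k2 c)).sub (k3 c))
    (fun σ hσ c ↦ by
      simpa only [sub_apply, add_apply, aL_apply, ipL_apply, hγ] using
        h.integral_snd hf hu₁ hu₂ hn hσ c) b z w
  simp only [sub_apply, add_apply] at this
  rw [intervalIntegral.integral_sub ((intervalIntegrable_bilin _ i1 b z w).add
    (intervalIntegrable_bilin _ i2 b z w)) (intervalIntegrable_bilin γ i3 b z w), sub_eq_zero]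
    at this
  simpa only [sub_neg_eq_add, hγ] using this

lemma deriv_eq_of_affine {α b : ℝ} {V : Type*} [NormedAddCommGroup V] [NormedSpace ℝ V]
    {U : ℝ → V} {ζ η : V}
    (hU : ∀ s ∈ Ioc α b, U s = affine b ζ η s) {s : ℝ} (hs : s ∈ Ioo α b) : deriv U s = η := by
  refine ((hasDerivAt_affine b ζ η s).congr_of_eventuallyEq ?_).deriv
  filter_upwards [Ioo_mem_nhds hs.1 hs.2] with r hr
  exact hU r ⟨hr.1, hr.2.le⟩

lemma IsPiecewisePoly.leftLim_eq (hq : q = 0 ∨ q = 1) {v : ℝ → H10 Ω} (hv : IsPiecewisePoly 𝓜 q v)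
    (hn : n < 𝓜.N) (h0 : n ≠ 0) : Function.leftLim v (𝓜.t n) = v (𝓜.t n) := by
  obtain ⟨n, rfl⟩ := Nat.exists_eq_succ_of_ne_zero h0
  obtain ⟨z, w, -, h⟩ := hv.exists_affine hq (n := n) (by omega)
  exact TimeMesh.leftLim_eq (by omega) h (continuous_affine _ z w).continuousWithinAt

variable {ζ₁ η₁ ζ₂ η₂ : H10 Ω}

/-- Consistency: the discrete and the exact solution satisfy the same equations for H₀¹-valued
affine test functions on one subinterval. Testing with (V, 0) gives the first identity and with (0,
V) the second. -/
lemma error_equations (hq : q = 0 ∨ q = 1) (hf : IntegrableOn f (Ioo 0 T))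
    (hu₁ : IsPiecewiseC 𝓜 (q + 1) u₁) (hu₂ : IsPiecewiseC 𝓜 (q + 1) u₂)
    (h : IsWaveSolution 𝓜 f u₀ v₀ u₁ u₂) (hU : IsDGSolution 𝓜 q f u₀ v₀ U₁ U₂) (hn : n < 𝓜.N)
    (hU₁ : ∀ s ∈ Ioc (𝓜.t n) (𝓜.t (n + 1)), U₁ s = affine (𝓜.t (n + 1)) ζ₁ η₁ s)
    (hU₂ : ∀ s ∈ Ioc (𝓜.t n) (𝓜.t (n + 1)), U₂ s = affine (𝓜.t (n + 1)) ζ₂ η₂ s)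
    (z : H10 Ω) {w : H10 Ω} (hw : w ∈ slopes Ω q) :
    (aL Ω (ζ₁ - u₁ (𝓜.t (n + 1))) z -
        aL Ω (U₁ (𝓜.t n) - u₁ (𝓜.t n)) (affine (𝓜.t (n + 1)) z w (𝓜.t n)) -
        (∫ s in (𝓜.t n)..(𝓜.t (n + 1)), aL Ω (affine (𝓜.t (n + 1)) ζ₁ η₁ s - u₁ s) w) =
      ∫ s in (𝓜.t n)..(𝓜.t (n + 1)),
        aL Ω (affine (𝓜.t (n + 1)) ζ₂ η₂ s - u₂ s) (affine (𝓜.t (n + 1)) z w s)) ∧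
    (ipL Ω (ζ₂ - u₂ (𝓜.t (n + 1))) z -
        ipL Ω (U₂ (𝓜.t n) - u₂ (𝓜.t n)) (affine (𝓜.t (n + 1)) z w (𝓜.t n)) -
        (∫ s in (𝓜.t n)..(𝓜.t (n + 1)), ipL Ω (affine (𝓜.t (n + 1)) ζ₂ η₂ s - u₂ s) w) =
      - ∫ s in (𝓜.t n)..(𝓜.t (n + 1)),
        aL Ω (affine (𝓜.t (n + 1)) ζ₁ η₁ s - u₁ s) (affine (𝓜.t (n + 1)) z w s)) := by
  obtain ⟨⟨hp₁, hp₂⟩, heq, rfl, rfl⟩ := hU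
  have hlt := 𝓜.t_lt n hn
  have i1 := (hu₁.2 n hn).continuousOn.intervalIntegrable_of_Icc (μ := volume) hlt.le
  have i2 := (hu₂.2 n hn).continuousOn.intervalIntegrable_of_Icc (μ := volume) hlt.le
  have j1 := (continuous_affine (𝓜.t (n + 1)) ζ₁ η₁).intervalIntegrable (μ := volume)
    (𝓜.t n) (𝓜.t (n + 1))
  have j2 := (continuous_affine (𝓜.t (n + 1)) ζ₂ η₂).intervalIntegrable (μ := volume)
    (𝓜.t n) (𝓜.t (n + 1))
  have hz := isPiecewisePoly_localize hq hn (zero_mem (slopes Ω q)) (z := 0) (𝓜.t (n + 1))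
  have hzw := isPiecewisePoly_localize hq hn hw (z := z) (𝓜.t (n + 1))
  have ha0 : affine (𝓜.t (n + 1)) (0 : H10 Ω) 0 = fun _ ↦ 0 := by ext1 s; simp [affine]
  have hc := continuous_affine (𝓜.t (n + 1)) z w
  have r1 := TimeMesh.rightLim_eq hn hU₁ (continuous_affine _ ζ₁ η₁).continuousWithinAt
  have r2 := TimeMesh.rightLim_eq hn hU₂ (continuous_affine _ ζ₂ η₂).continuousWithinAt
  rw [ha0] at hz
  constructor
  · have h1 := localized_equation hn hc continuous_const (hp₁.leftLim_eq hq hn)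
      (hp₂.leftLim_eq hq hn) (heq _ _ hzw hz)
    have h2 := h.integral_fst_affine hu₁ hu₂ hn (𝓜.t (n + 1)) z w
    have := error_equation hlt (aL Ω) (hu₁.2 n hn)
      (intervalIntegrable_bilin (aL Ω) j2 (𝓜.t (n + 1)) z w)
      (intervalIntegrable_bilin (aL Ω) i2 (𝓜.t (n + 1)) z w) (ζ := ζ₁) (η := η₁) (x := U₁ (𝓜.t n))
      (c := 0) ?_ h2
    · simpa only [map_sub, sub_apply] using this
    · rw [← r1]
      simp only [a_zero_right, ip_zero_right, add_zero, fn_zero, inner_zero_right,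
        intervalIntegral.integral_zero] at h1
      rw [← h1]
      congr 1
      refine intervalIntegral.integral_congr_Ioo_of_le hlt.le fun s hs ↦ ?_
      simp only [aL_apply]
      rw [deriv_eq_of_affine hU₁ hs, hU₂ s ⟨hs.1, hs.2.le⟩]
  · have h1 := localized_equation hn continuous_const hc (hp₁.leftLim_eq hq hn)
      (hp₂.leftLim_eq hq hn) (heq _ _ hz hzw)
    have h2 := h.integral_snd_affine hf hu₁ hu₂ hn (𝓜.t (n + 1)) z w
    have e1 := (intervalIntegrable_bilin (aL Ω) j1 (𝓜.t (n + 1)) z w).neg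
    have e2 := (intervalIntegrable_bilin (aL Ω) i1 (𝓜.t (n + 1)) z w).neg
    simp only [Pi.neg_def] at e1 e2
    have := error_equation hlt (ipL Ω) (hu₂.2 n hn) e1 e2 (ζ := ζ₂) (η := η₂)
      (x := U₂ (𝓜.t n)) (c := _) ?_ h2
    · rw [this, ← intervalIntegral.integral_neg]
      congr 1
      ext1 s
      simp only [map_sub, sub_apply]
      ring
    · rw [← r2]
      simp only [a_zero_right, sub_self, zero_add, add_zero] at h1
      refine Eq.trans ?_ h1
      congr 1
      refine intervalIntegral.integral_congr_Ioo_of_le hlt.le fun s hs ↦ ?_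
      simp only [aL_apply, ipL_apply]
      rw [deriv_eq_of_affine hU₂ hs, hU₁ s ⟨hs.1, hs.2.le⟩, sub_neg_eq_add]

end Galerkin

/-! ### Interpolation in time -/

section Interpolation

lemma abs_sub_le_of_hasDerivAt {g g' : ℝ → ℝ} {α b M : ℝ} (hg : ContinuousOn g (Icc α b))
    (hd : ∀ s ∈ Ioo α b, HasDerivAt g (g' s) s) (hM : ∀ s ∈ Ioo α b, |g' s| ≤ M) {s : ℝ}
    (hs : s ∈ Icc α b) : |g b - g s| ≤ M * (b - s) := by
  rcases hs.2.eq_or_lt with rfl | hlt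
  · simp
  obtain ⟨c, hc, h⟩ := exists_hasDerivAt_eq_slope g g' hlt (hg.mono (Icc_subset_Icc_left hs.1))
    fun x hx ↦ hd x ⟨hs.1.trans_lt hx.1, hx.2⟩
  rw [eq_div_iff (sub_pos.mpr hlt).ne'] at h
  rw [← h, abs_mul, abs_of_pos (sub_pos.mpr hlt)]
  exact mul_le_mul_of_nonneg_right (hM c ⟨hs.1.trans_lt hc.1, hc.2⟩) (sub_pos.mpr hlt).le

variable {V : Type*} [NormedAddCommGroup V] [NormedSpace ℝ V]

lemma integral_affine [CompleteSpace V] (α b : ℝ) (z w : V) :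
    ∫ s in α..b, affine b z w s = (b - α) • z - ((b - α) ^ 2 / 2) • w := by
  have h : ∫ s in α..b, (s - b) = -((b - α) ^ 2 / 2) := by
    rw [intervalIntegral.integral_sub (by simp) (by simp), integral_id]
    simp
    ring
  have h1 : IntervalIntegrable (fun s : ℝ ↦ (s - b) • w) volume α b :=
    Continuous.intervalIntegrable (by fun_prop) _ _
  simp only [affine]
  rw [intervalIntegral.integral_add (by simp) h1, intervalIntegral.integral_smul_const, h]
  simp [sub_eq_add_neg]

/-- Subtracting the linear function with slope g'(c), c the midpoint, leaves k with |k'| ≤ Mh and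
|k(b) - k| ≤ Mh², where h = b - α. The zero mean forces h |y - g'(c)| ≤ 2Mh², and the two bounds add
up to the constant 3. The midpoint serves because derivatives are available only in the open
interval. -/
lemma abs_affine_sub_le {g g' g'' : ℝ → ℝ} {α b M y : ℝ} (hα : α < b)
    (hg : ContinuousOn g (Icc α b))
    (hd : ∀ s ∈ Ioo α b, HasDerivAt g (g' s) s) (hd' : ∀ s ∈ Ioo α b, HasDerivAt g' (g'' s) s)
    (hM : ∀ s ∈ Ioo α b, |g'' s| ≤ M) (hy : ∫ s in α..b, (affine b (g b) y s - g s) = 0) {s : ℝ}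
    (hs : s ∈ Icc α b) : |affine b (g b) y s - g s| ≤ 3 * (b - α) ^ 2 * M := by
  set h := b - α with hh
  have hpos : 0 < h := sub_pos.mpr hα
  let c := (α + b) / 2
  have hc : c ∈ Ioo α b := ⟨by simp only [c]; linarith, by simp only [c]; linarith⟩
  have hM0 : 0 ≤ M := (abs_nonneg _).trans (hM c hc)
  have hg'c : ∀ s ∈ Ioo α b, |g' s - g' c| ≤ M * h := by
    intro s hs
    have := Convex.norm_image_sub_le_of_norm_hasDerivWithin_le (f := g') (f' := g'') (C := M)
      (fun x hx ↦ (hd' x hx).hasDerivWithinAt) hM (convex_Ioo α b) hc hs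
    refine this.trans (mul_le_mul_of_nonneg_left ?_ hM0)
    rw [Real.norm_eq_abs, abs_le]
    constructor <;> linarith [hs.1, hs.2, hc.1, hc.2]
  let k : ℝ → ℝ := fun s ↦ g s - g' c * s
  have hk : ContinuousOn k (Icc α b) := hg.sub (by fun_prop)
  have hkd : ∀ s ∈ Ioo α b, HasDerivAt k (g' s - g' c) s := fun s hs ↦ by
    have := (hd s hs).sub ((hasDerivAt_id s).const_mul (g' c))
    rw [mul_one] at this
    exact this
  have hkb : ∀ s ∈ Icc α b, |k b - k s| ≤ M * h ^ 2 := fun s hs ↦ by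
    refine (abs_sub_le_of_hasDerivAt hk hkd hg'c hs).trans ?_
    have : b - s ≤ h := by linarith [hs.1]
    calc M * h * (b - s) ≤ M * h * h := by gcongr
      _ = M * h ^ 2 := by ring
  have hE (s : ℝ) : affine b (g b) y s - g s = affine b (k b) (y - g' c) s - k s := by
    simp only [affine, k, smul_eq_mul]; ring
  have hi := hk.intervalIntegrable_of_Icc (μ := volume) hα.le
  have hki : |∫ s in α..b, (k b - k s)| ≤ M * h ^ 2 * h := by
    have := intervalIntegral.norm_integral_le_of_norm_le_const (f := fun s ↦ k b - k s)
      (a := α) (b := b) (C := M * h ^ 2) fun s hs ↦ hkb s (by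
        rw [uIoc_of_le hα.le] at hs; exact Ioc_subset_Icc_self hs)
    rwa [abs_of_pos hpos] at this
  have hy' : |y - g' c| * h ≤ 2 * (M * h ^ 2) := by
    simp only [hE] at hy
    rw [intervalIntegral.integral_sub ((continuous_affine _ _ _).intervalIntegrable _ _) hi,
      integral_affine] at hy
    rw [intervalIntegral.integral_sub (by simp) hi, intervalIntegral.integral_const] at hki
    simp only [smul_eq_mul, ← hh] at hy hki
    rw [show h * k b - ∫ s in α..b, k s = h ^ 2 / 2 * (y - g' c) by linarith, abs_mul,
      abs_of_pos (by positivity)] at hki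
    have : h ^ 2 / 2 * |y - g' c| = (|y - g' c| * h) / 2 * h := by ring
    rw [this] at hki
    have := le_of_mul_le_mul_right hki hpos
    linarith
  rw [hE, affine, smul_eq_mul]
  calc |k b + (s - b) * (y - g' c) - k s| = |(k b - k s) + (s - b) * (y - g' c)| := by
        congr 1; ring
    _ ≤ |k b - k s| + |s - b| * |y - g' c| := by rw [← abs_mul]; exact abs_add_le _ _
    _ ≤ M * h ^ 2 + h * |y - g' c| := by
        gcongr
        · exact hkb s hs
        · rw [abs_le]; constructor <;> linarith [hs.1, hs.2]
    _ ≤ 3 * h ^ 2 * M := by linarith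

variable [CompleteSpace V]

/-- The slope of the interpolant of degree `q ≤ 1` that agrees with `u` at the right end point `b`
and, if `q = 1`, has the same mean value as `u`. -/
def interpSlope (q : ℕ) (α b : ℝ) (u : ℝ → V) : V :=
  if q = 0 then 0 else (2 / (b - α) ^ 2) • ∫ s in α..b, (u b - u s)

/-- The interpolation error. -/
def interpError (q : ℕ) (α b : ℝ) (u : ℝ → V) (s : ℝ) : V :=
  affine b (u b) (interpSlope q α b u) s - u s

variable {u : ℝ → V} {α b : ℝ} {q : ℕ}

lemma integral_interpError (hq : q ≠ 0) (hα : α < b) (hu : ContinuousOn u (Icc α b)) :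
    ∫ s in α..b, interpError q α b u s = 0 := by
  have hi := hu.intervalIntegrable_of_Icc (μ := volume) hα.le
  have hpos : b - α ≠ 0 := (sub_pos.mpr hα).ne'
  simp only [interpError]
  rw [intervalIntegral.integral_sub ((continuous_affine _ _ _).intervalIntegrable _ _) hi,
    integral_affine, interpSlope, if_neg hq, intervalIntegral.integral_sub (by simp) hi, smul_smul,
    intervalIntegral.integral_const]
  have : (b - α) ^ 2 / 2 * (2 / (b - α) ^ 2) = 1 := by field_simp
  rw [this, one_smul]
  abel

/-- Interpolation commutes with continuous functionals, so the bound is the scalar one for ℓ ∘ u.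
Only the size of ℓ on the derivative enters, so ℓ may encode a seminorm that is not continuous on
H₀¹, such as ‖A·‖. -/
lemma abs_interpError_le (hq : q = 0 ∨ q = 1) (hα : α < b)
    (hu : ContDiffOn ℝ (q + 1 : ℕ) u (Icc α b)) (ℓ : V →L[ℝ] ℝ) {M : ℝ}
    (hM : ∀ s ∈ Ioo α b, |ℓ (iteratedDeriv (q + 1) u s)| ≤ M) {s : ℝ} (hs : s ∈ Icc α b) :
    |ℓ (interpError q α b u s)| ≤ 3 * (b - α) ^ (q + 1) * M := by
  have hc : ContinuousOn (fun s ↦ ℓ (u s)) (Icc α b) := ℓ.continuous.comp_continuousOn hu.continuousOn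
  have hd : ∀ s ∈ Ioo α b, HasDerivAt (fun s ↦ ℓ (u s)) (ℓ (deriv u s)) s := fun s hs ↦
    ℓ.hasFDerivAt.comp_hasDerivAt s (hasDerivAt_of_contDiffOn_Icc hu hs)
  have hM0 : 0 ≤ M := (abs_nonneg _).trans (hM ((α + b) / 2) ⟨by linarith, by linarith⟩)
  have hpos : 0 < b - α := sub_pos.mpr hα
  rcases hq with rfl | rfl
  · simp only [zero_add, iteratedDeriv_one] at hM
    have h := abs_sub_le_of_hasDerivAt hc hd hM hs
    have e : ℓ (interpError 0 α b u s) = ℓ (u b) - ℓ (u s) := by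
      simp [interpError, interpSlope, affine]
    rw [e]
    refine h.trans ?_
    have : M * (b - s) ≤ M * (b - α) := by
      have := hs.1
      gcongr
    have : 0 ≤ M * (b - α) := by positivity
    simp only [zero_add, pow_one]
    linarith
  · rw [iteratedDeriv_succ, iteratedDeriv_one] at hM
    have hd' : ∀ s ∈ Ioo α b, HasDerivAt (fun s ↦ ℓ (deriv u s)) (ℓ (deriv (deriv u) s)) s := by
      intro s hs
      refine ℓ.hasFDerivAt.comp_hasDerivAt s (DifferentiableAt.hasDerivAt ?_)
      have h2 : ContDiffOn ℝ 1 (deriv u) (Ioo α b) :=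
        (hu.mono Ioo_subset_Icc_self).deriv_of_isOpen isOpen_Ioo (by norm_num)
      exact (h2.contDiffAt (isOpen_Ioo.mem_nhds hs)).differentiableAt (by simp)
    have he (s : ℝ) : ℓ (interpError 1 α b u s) =
        affine b (ℓ (u b)) (ℓ (interpSlope 1 α b u)) s - ℓ (u s) := by
      simp [interpError, affine]
    have hcI : ContinuousOn (interpError 1 α b u) (Icc α b) :=
      (continuous_affine _ _ _).continuousOn.sub hu.continuousOn
    rw [he]
    refine abs_affine_sub_le hα hc hd hd' hM ?_ hs
    simp only [← he]
    rw [intervalIntegral_clm _ (hcI.intervalIntegrable_of_Icc hα.le),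
      integral_interpError one_ne_zero hα hu.continuousOn, map_zero]

end Interpolation

/-! ### Stability -/

section Stability

variable {K : Type*} [NormedAddCommGroup K] [NormedSpace ℝ K]

/-- An affine function is a convex combination of its end values z at b and z - (b - α)w at α. -/
lemma norm_affine_le {α b M : ℝ} (hα : α < b) {z w : K} (h1 : ‖z‖ ≤ M)
    (h2 : ‖z - (b - α) • w‖ ≤ M) {s : ℝ} (hs : s ∈ Icc α b) : ‖affine b z w s‖ ≤ M := by
  have hpos : 0 < b - α := sub_pos.mpr hα
  have e : affine b z w s = ((s - α) / (b - α)) • z + ((b - s) / (b - α)) • (z - (b - α) • w) := by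
    rw [smul_sub, smul_smul, div_mul_cancel₀ _ hpos.ne', add_sub, ← add_smul, ← add_div,
      show s - α + (b - s) = b - α by ring, div_self hpos.ne', one_smul, affine]
    module
  rw [e]
  have h1' : z ∈ Metric.closedBall (0 : K) M := by simpa using h1
  have h2' : z - (b - α) • w ∈ Metric.closedBall (0 : K) M := by simpa using h2
  have := convex_closedBall (0 : K) M h1' h2' (div_nonneg (sub_nonneg.mpr hs.1) hpos.le)
    (div_nonneg (sub_nonneg.mpr hs.2) hpos.le) (by field_simp; ring)
  rwa [mem_closedBall_zero_iff] at this

/-- The left side is the error equation tested with θ itself: x is the left limit at the old node, z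
- hw the right limit, z the value at the new node, and hz·w - h²w·w/2 the integral of θ·w. The
square of the jump z - hw - x is the dissipation of the dG method. -/
lemma energy_identity {K : Type*} [NormedAddCommGroup K] [InnerProductSpace ℝ K] (h : ℝ)
    (x z w : K) :
    inner ℝ z z - inner ℝ x (z - h • w) - (h * inner ℝ z w - h ^ 2 / 2 * inner ℝ w w) =
      (‖z‖ ^ 2 + ‖z - h • w - x‖ ^ 2 - ‖x‖ ^ 2) / 2 := by
  simp only [← real_inner_self_eq_norm_sq, inner_sub_left, inner_sub_right, inner_smul_left,
    inner_smul_right, real_inner_comm z w, real_inner_comm z x, real_inner_comm w x,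
    RCLike.conj_to_real]
  ring

lemma le_of_sq_le_mul {M R : ℝ} (hM : 0 ≤ M) (hR : 0 ≤ R) (h : M ^ 2 ≤ 8 * R * M) : M ≤ 8 * R := by
  rcases hM.eq_or_lt with rfl | hpos
  · positivity
  · exact le_of_mul_le_mul_right (by linarith [sq M]) hpos

/-- Accumulation of the energy estimates on the subintervals. -/
lemma stability (N : ℕ) (X₁ X₂ J₁ J₂ Y₁ Y₂ g : ℕ → ℝ)
    (hX₁ : ∀ n, 0 ≤ X₁ n) (hX₁0 : X₁ 0 = 0) (hX₂0 : X₂ 0 = 0)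
    (hg : ∀ n < N, 0 ≤ g n) (hY₁ : ∀ n < N, Y₁ n ≤ X₁ n + J₁ n)
    (hY₂ : ∀ n < N, Y₂ n ≤ X₂ n + J₂ n)
    (step : ∀ n < N, ∀ M, X₁ (n + 1) ≤ M → X₂ (n + 1) ≤ M → Y₁ n ≤ M → Y₂ n ≤ M →
      X₁ (n + 1) ^ 2 + X₂ (n + 1) ^ 2 + (J₁ n ^ 2 + J₂ n ^ 2) ≤
        X₁ n ^ 2 + X₂ n ^ 2 + 2 * M * g n) :
    ∀ n < N, (X₁ (n + 1) ≤ 8 * ∑ m ∈ Finset.range N, g m) ∧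
      (X₂ (n + 1) ≤ 8 * ∑ m ∈ Finset.range N, g m) ∧
      (Y₁ n ≤ 8 * ∑ m ∈ Finset.range N, g m) ∧ Y₂ n ≤ 8 * ∑ m ∈ Finset.range N, g m := by
  intro n₀ hn₀
  set R := ∑ m ∈ Finset.range N, g m with hR
  have hR0 : 0 ≤ R := Finset.sum_nonneg fun m hm ↦ hg m (Finset.mem_range.mp hm)
  -- One bound M for all node values X and all right limits Y over the whole mesh, attained on
  -- subinterval k. Every step is used with this M, so the steps telescope without growth.
  let F : ℕ → ℝ := fun n ↦ max (max (X₁ (n + 1)) (X₂ (n + 1))) (max (Y₁ n) (Y₂ n))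
  obtain ⟨k, hk, hmax⟩ := Finset.exists_max_image (Finset.range N) F ⟨n₀, Finset.mem_range.mpr hn₀⟩
  rw [Finset.mem_range] at hk
  set M := F k with hMdef
  have hM (n : ℕ) (hn : n < N) : X₁ (n + 1) ≤ M ∧ X₂ (n + 1) ≤ M ∧ Y₁ n ≤ M ∧ Y₂ n ≤ M := by
    have := hmax n (Finset.mem_range.mpr hn)
    simp only [F, max_le_iff] at this
    exact ⟨this.1.1, this.1.2, this.2.1, this.2.2⟩
  have hM0 : 0 ≤ M := (hX₁ _).trans (hM k hk).1
  have hstep (n : ℕ) (hn : n < N) := step n hn M (hM n hn).1 (hM n hn).2.1 (hM n hn).2.2.1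
    (hM n hn).2.2.2
  have hacc : ∀ n ≤ N, X₁ n ^ 2 + X₂ n ^ 2 ≤ 2 * M * ∑ m ∈ Finset.range n, g m := by
    intro n
    induction n with
    | zero => simp [hX₁0, hX₂0]
    | succ n ih =>
      intro hn
      rw [Finset.sum_range_succ, mul_add]
      linarith [ih (by omega), hstep n hn, sq_nonneg (J₁ n), sq_nonneg (J₂ n)]
  have hsum (n : ℕ) (hn : n ≤ N) : 2 * M * ∑ m ∈ Finset.range n, g m ≤ 2 * M * R := by
    refine mul_le_mul_of_nonneg_left (Finset.sum_le_sum_of_subset_of_nonneg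
      (Finset.range_mono hn) fun m hm _ ↦ hg m (Finset.mem_range.mp hm)) (by positivity)
  have hXs (n : ℕ) (hn : n ≤ N) : X₁ n ^ 2 + X₂ n ^ 2 ≤ 2 * M * R := (hacc n hn).trans (hsum n hn)
  -- The dissipation, otherwise dropped, is kept on subinterval k: it controls the jump there.
  have hJs : J₁ k ^ 2 + J₂ k ^ 2 ≤ 2 * M * R := by
    have h1 := hsum (k + 1) hk
    rw [Finset.sum_range_succ, mul_add] at h1
    linarith [hacc k hk.le, hstep k hk, sq_nonneg (X₁ (k + 1)), sq_nonneg (X₂ (k + 1))]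
  -- If M is a node value, M² ≤ 2MR. If it is a right limit, then M ≤ X + J and M² ≤ 2(X² + J²) ≤
  -- 8MR.
  have hfin : M ^ 2 ≤ 8 * R * M := by
    have hX := hXs (k + 1) hk
    have hXk := hXs k hk.le
    rcases max_choice (max (X₁ (k + 1)) (X₂ (k + 1))) (max (Y₁ k) (Y₂ k)) with h | h
    · have hMe : M = max (X₁ (k + 1)) (X₂ (k + 1)) := h
      have hMR : 0 ≤ M * R := by positivity
      rcases max_choice (X₁ (k + 1)) (X₂ (k + 1)) with h | h <;> rw [h] at hMe
      · have : M ^ 2 = X₁ (k + 1) ^ 2 := by rw [hMe]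
        linarith [sq_nonneg (X₂ (k + 1))]
      · have : M ^ 2 = X₂ (k + 1) ^ 2 := by rw [hMe]
        linarith [sq_nonneg (X₁ (k + 1))]
    · have hMe : M = max (Y₁ k) (Y₂ k) := h
      rcases max_choice (Y₁ k) (Y₂ k) with h | h <;> rw [h] at hMe
      · have : M ^ 2 ≤ (X₁ k + J₁ k) ^ 2 := pow_le_pow_left₀ hM0 (hMe ▸ hY₁ k hk) 2
        linarith [sq_nonneg (X₁ k - J₁ k), sq_nonneg (X₂ k), sq_nonneg (J₂ k)]
      · have : M ^ 2 ≤ (X₂ k + J₂ k) ^ 2 := pow_le_pow_left₀ hM0 (hMe ▸ hY₂ k hk) 2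
        linarith [sq_nonneg (X₂ k - J₂ k), sq_nonneg (X₁ k), sq_nonneg (J₁ k)]
  have := le_of_sq_le_mul hM0 hR0 hfin
  obtain ⟨h1, h2, h3, h4⟩ := hM n₀ hn₀
  exact ⟨h1.trans this, h2.trans this, h3.trans this, h4.trans this⟩

end Stability

variable {f : ℝ → L2 Ω} {u₀ v₀ : H10 Ω} {u₁ u₂ U₁ U₂ : ℝ → H10 Ω} {q n : ℕ}

/-! ### The energy estimate -/

lemma affine_sub_eq {V : Type*} [NormedAddCommGroup V] [NormedSpace ℝ V] [CompleteSpace V] (q : ℕ)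
    (α b : ℝ) (u : ℝ → V) (ζ η : V) (s : ℝ) :
    affine b ζ η s - u s =
      affine b (ζ - u b) (η - interpSlope q α b u) s + interpError q α b u s := by
  simp only [affine, interpError]
  module

lemma continuousOn_interpError {V : Type*} [NormedAddCommGroup V] [NormedSpace ℝ V]
    [CompleteSpace V] {u : ℝ → V} {α b : ℝ} (hu : ContinuousOn u (Icc α b)) :
    ContinuousOn (interpError q α b u) (Icc α b) :=
  (continuous_affine _ _ _).continuousOn.sub hu

/-- The interpolation error drops out: for q = 1 it has mean zero, and for q = 0 the slope w is
zero. -/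
lemma integral_affine_sub_slope (β : H10 Ω →L[ℝ] H10 Ω →L[ℝ] ℝ) {u : ℝ → H10 Ω} {α b : ℝ}
    (hα : α < b) (hu : ContinuousOn u (Icc α b)) (ζ η : H10 Ω) {w : H10 Ω} (hw : w ∈ slopes Ω q) :
    ∫ s in α..b, β (affine b ζ η s - u s) w =
      (b - α) * β (ζ - u b) w - (b - α) ^ 2 / 2 * β (η - interpSlope q α b u) w := by
  rcases eq_or_ne q 0 with rfl | hq
  · obtain rfl : w = 0 := by simpa [slopes] using hw
    simp
  · have hi := (continuousOn_interpError (q := q) hu).intervalIntegrable_of_Icc (μ := volume) hα.le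
    have ha := (continuous_affine b (ζ - u b) (η - interpSlope q α b u)).intervalIntegrable
      (μ := volume) α b
    have e (s : ℝ) : β (affine b ζ η s - u s) w =
        β.flip w (affine b (ζ - u b) (η - interpSlope q α b u) s + interpError q α b u s) := by
      rw [← affine_sub_eq]; rfl
    simp only [e]
    rw [intervalIntegral_clm _ (ha.add hi), intervalIntegral.integral_add ha hi,
      integral_interpError hq hα hu, integral_affine, add_zero]
    simp

lemma affine_map {V W : Type*} [NormedAddCommGroup V] [NormedSpace ℝ V] [NormedAddCommGroup W]
    [NormedSpace ℝ W] (F : V →L[ℝ] W) (b : ℝ) (z w : V) (s : ℝ) :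
    F (affine b z w s) = affine b (F z) (F w) s := by
  simp [affine]

lemma affine_left {V : Type*} [NormedAddCommGroup V] [NormedSpace ℝ V] (α b : ℝ) (z w : V) :
    affine b z w α = z - (b - α) • w := by
  simp only [affine]; module

/-- This makes Sθ an admissible discrete test function. -/
lemma map_mem_slopes (S : H10 Ω →L[ℝ] H10 Ω) {w : H10 Ω} (hw : w ∈ slopes Ω q) :
    S w ∈ slopes Ω q := by
  rcases eq_or_ne q 0 with rfl | hq
  · obtain rfl : w = 0 := by simpa [slopes] using hw
    simp
  · simp [slopes, hq]

lemma interpSlope_mem_slopes (α b : ℝ) (u : ℝ → H10 Ω) : interpSlope q α b u ∈ slopes Ω q := by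
  rcases eq_or_ne q 0 with rfl | hq
  · simp [interpSlope]
  · simp [slopes, hq]

section Energy

variable {K₁ K₀ : Type*} [NormedAddCommGroup K₁] [InnerProductSpace ℝ K₁]
  [NormedAddCommGroup K₀] [InnerProductSpace ℝ K₀]
  {S : H10 Ω →L[ℝ] H10 Ω} {T₁ : H10 Ω →L[ℝ] K₁} {T₀ : H10 Ω →L[ℝ] K₀}

/-- The energy estimate on one subinterval `(α, b)`, for `θ = (θ₁, θ₂)` affine with values
`Z₁, Z₂` at `b` and slopes `W₁, W₂`. -/
lemma energy_step {α b R₁ R₂ M : ℝ} (hα : α < b) {X₁ X₂ Z₁ Z₂ W₁ W₂ : H10 Ω}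
    (hT₁ : ∀ v w, aL Ω v (S w) = inner ℝ (T₁ v) (T₁ w))
    (hT₀ : ∀ v w, ipL Ω v (S w) = inner ℝ (T₀ v) (T₀ w)) {ρ₁ ρ₂ : ℝ → H10 Ω}
    (hρ₁ : ContinuousOn ρ₁ (Icc α b)) (hρ₂ : ContinuousOn ρ₂ (Icc α b))
    (h₁ : aL Ω Z₁ (S Z₁) - aL Ω X₁ (affine b (S Z₁) (S W₁) α) -
        ((b - α) * aL Ω Z₁ (S W₁) - (b - α) ^ 2 / 2 * aL Ω W₁ (S W₁)) =
      ∫ s in α..b, aL Ω (affine b Z₂ W₂ s + ρ₂ s) (affine b (S Z₁) (S W₁) s))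
    (h₂ : ipL Ω Z₂ (S Z₂) - ipL Ω X₂ (affine b (S Z₂) (S W₂) α) -
        ((b - α) * ipL Ω Z₂ (S W₂) - (b - α) ^ 2 / 2 * ipL Ω W₂ (S W₂)) =
      - ∫ s in α..b, aL Ω (affine b Z₁ W₁ s + ρ₁ s) (affine b (S Z₂) (S W₂) s))
    (hR₁0 : 0 ≤ R₁) (hR₂0 : 0 ≤ R₂)
    (hR₂ : ∀ s ∈ Icc α b, ‖T₁ (ρ₂ s)‖ ≤ R₂)
    (hR₁ : ∀ s ∈ Icc α b, ∀ c, |aL Ω (ρ₁ s) (S c)| ≤ R₁ * ‖T₀ c‖)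
    (hM₁ : ‖T₁ Z₁‖ ≤ M) (hM₂ : ‖T₀ Z₂‖ ≤ M) (hM₁' : ‖T₁ (Z₁ - (b - α) • W₁)‖ ≤ M)
    (hM₂' : ‖T₀ (Z₂ - (b - α) • W₂)‖ ≤ M) :
    ‖T₁ Z₁‖ ^ 2 + ‖T₀ Z₂‖ ^ 2 +
        (‖T₁ (Z₁ - (b - α) • W₁ - X₁)‖ ^ 2 + ‖T₀ (Z₂ - (b - α) • W₂ - X₂)‖ ^ 2) ≤
      ‖T₁ X₁‖ ^ 2 + ‖T₀ X₂‖ ^ 2 + 2 * M * ((b - α) * (R₁ + R₂)) := by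
  have hM0 : 0 ≤ M := (norm_nonneg _).trans hM₁
  simp only [← affine_map S, hT₁] at h₁
  simp only [← affine_map S, hT₀] at h₂
  rw [affine_left α] at h₁ h₂
  have i₁ : ContinuousOn (fun s ↦ aL Ω (affine b Z₂ W₂ s + ρ₂ s) (S (affine b Z₁ W₁ s)))
      (Icc α b) :=
    ((aL Ω).continuous.comp_continuousOn ((continuous_affine _ _ _).continuousOn.add hρ₂)).clm_apply
      (S.continuous.comp (continuous_affine _ _ _)).continuousOn
  simp only [hT₁] at i₁
  have i₂ : ContinuousOn (fun s ↦ aL Ω (affine b Z₁ W₁ s + ρ₁ s) (S (affine b Z₂ W₂ s)))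
      (Icc α b) :=
    ((aL Ω).continuous.comp_continuousOn ((continuous_affine _ _ _).continuousOn.add hρ₁)).clm_apply
      (S.continuous.comp (continuous_affine _ _ _)).continuousOn
  have hsum := congrArg₂ (· + ·) h₁ h₂
  rw [← sub_eq_add_neg, ← intervalIntegral.integral_sub (i₁.intervalIntegrable_of_Icc hα.le)
    (i₂.intervalIntegrable_of_Icc hα.le)] at hsum
  have hbound : ∫ s in α..b, (inner ℝ (T₁ (affine b Z₂ W₂ s + ρ₂ s)) (T₁ (affine b Z₁ W₁ s)) -
      aL Ω (affine b Z₁ W₁ s + ρ₁ s) (S (affine b Z₂ W₂ s))) ≤ (R₁ + R₂) * M * (b - α) := by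
    refine (le_abs_self _).trans ?_
    rw [← Real.norm_eq_abs, ← abs_of_pos (sub_pos.mpr hα)]
    refine intervalIntegral.norm_integral_le_of_norm_le_const fun s hs ↦ ?_
    rw [uIoc_of_le hα.le] at hs
    have hs' := Ioc_subset_Icc_self hs
    have n1 : ‖T₁ (affine b Z₁ W₁ s)‖ ≤ M := by
      rw [affine_map]
      exact norm_affine_le hα hM₁ (by simpa only [map_sub, map_smul] using hM₁') hs'
    have n2 : ‖T₀ (affine b Z₂ W₂ s)‖ ≤ M := by
      rw [affine_map]
      exact norm_affine_le hα hM₂ (by simpa only [map_sub, map_smul] using hM₂') hs'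
    -- The coupling terms a(θ₂, Sθ₁) and a(θ₁, Sθ₂) both equal ⟨T₁θ₁, T₁θ₂⟩ and cancel; only terms
    -- with ρ survive.
    have e : inner ℝ (T₁ (affine b Z₂ W₂ s + ρ₂ s)) (T₁ (affine b Z₁ W₁ s)) -
        aL Ω (affine b Z₁ W₁ s + ρ₁ s) (S (affine b Z₂ W₂ s)) =
        inner ℝ (T₁ (ρ₂ s)) (T₁ (affine b Z₁ W₁ s)) - aL Ω (ρ₁ s) (S (affine b Z₂ W₂ s)) := by
      rw [map_add, map_add, add_apply, inner_add_left, hT₁,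
        real_inner_comm (T₁ (affine b Z₁ W₁ s))]
      ring
    rw [e, Real.norm_eq_abs]
    calc _ ≤ |inner ℝ (T₁ (ρ₂ s)) (T₁ (affine b Z₁ W₁ s))| +
          |aL Ω (ρ₁ s) (S (affine b Z₂ W₂ s))| := abs_sub _ _
      _ ≤ R₂ * M + R₁ * M := by
        gcongr
        · exact (abs_real_inner_le_norm _ _).trans
            (mul_le_mul (hR₂ s hs') n1 (norm_nonneg _) hR₂0)
        · exact (hR₁ s hs' _).trans (mul_le_mul_of_nonneg_left n2 hR₁0)
      _ = (R₁ + R₂) * M := by ring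
  have id₁ := energy_identity (b - α) (T₁ X₁) (T₁ Z₁) (T₁ W₁)
  have id₂ := energy_identity (b - α) (T₀ X₂) (T₀ Z₂) (T₀ W₂)
  simp only [← map_smul, ← map_sub] at id₁ id₂
  rw [id₁, id₂] at hsum
  linarith

/-- The difference of the dG solution and the interpolant of the exact solution, in the energy
norm determined by `T₁` and `T₀`. -/
lemma energy_bound (hq : q = 0 ∨ q = 1) (hf : IntegrableOn f (Ioo 0 T))
    (hu₁ : IsPiecewiseC 𝓜 (q + 1) u₁) (hu₂ : IsPiecewiseC 𝓜 (q + 1) u₂)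
    (h : IsWaveSolution 𝓜 f u₀ v₀ u₁ u₂) (hU : IsDGSolution 𝓜 q f u₀ v₀ U₁ U₂)
    (hT₁ : ∀ v w, a v (S w) = inner ℝ (T₁ v) (T₁ w))
    (hT₀ : ∀ v w, ip v (S w) = inner ℝ (T₀ v) (T₀ w))
    {R₁ R₂ : ℕ → ℝ} (hR₁0 : ∀ n < 𝓜.N, 0 ≤ R₁ n) (hR₂0 : ∀ n < 𝓜.N, 0 ≤ R₂ n)
    (hR₂ : ∀ n < 𝓜.N, ∀ s ∈ Icc (𝓜.t n) (𝓜.t (n + 1)),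
      ‖T₁ (interpError q (𝓜.t n) (𝓜.t (n + 1)) u₂ s)‖ ≤ R₂ n)
    (hR₁ : ∀ n < 𝓜.N, ∀ s ∈ Icc (𝓜.t n) (𝓜.t (n + 1)), ∀ c,
      |a (interpError q (𝓜.t n) (𝓜.t (n + 1)) u₁ s) (S c)| ≤ R₁ n * ‖T₀ c‖) :
    ∀ n < 𝓜.N, ∀ s ∈ Ioc (𝓜.t n) (𝓜.t (n + 1)),
      ‖T₁ (U₁ s - u₁ s - interpError q (𝓜.t n) (𝓜.t (n + 1)) u₁ s)‖ ≤
        8 * ∑ m ∈ Finset.range 𝓜.N, 𝓜.step m * (R₁ m + R₂ m) ∧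
      ‖T₀ (U₂ s - u₂ s - interpError q (𝓜.t n) (𝓜.t (n + 1)) u₂ s)‖ ≤
        8 * ∑ m ∈ Finset.range 𝓜.N, 𝓜.step m * (R₁ m + R₂ m) := by
  have hex (U : ℝ → H10 Ω) (hp : IsPiecewisePoly 𝓜 q U) (n : ℕ) : ∃ z w, n < 𝓜.N →
      w ∈ slopes Ω q ∧ ∀ s ∈ Ioc (𝓜.t n) (𝓜.t (n + 1)), U s = affine (𝓜.t (n + 1)) z w s := by
    by_cases hn : n < 𝓜.N
    · obtain ⟨z, w, hw, h⟩ := hp.exists_affine hq hn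
      exact ⟨z, w, fun _ ↦ ⟨hw, h⟩⟩
    · exact ⟨0, 0, fun h ↦ absurd h hn⟩
  choose ζ₁ η₁ hU₁ using hex U₁ hU.1.1
  choose ζ₂ η₂ hU₂ using hex U₂ hU.1.2
  have hend (U : ℝ → H10 Ω) (ζ η : ℕ → H10 Ω) (n : ℕ) (hn : n < 𝓜.N)
      (hU : ∀ s ∈ Ioc (𝓜.t n) (𝓜.t (n + 1)), U s = affine (𝓜.t (n + 1)) (ζ n) (η n) s) :
      U (𝓜.t (n + 1)) = ζ n := by
    rw [hU _ ⟨𝓜.t_lt n hn, le_rfl⟩]; simp [affine]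
  -- The slopes of θ = U - Πu on the subintervals.
  let W₁ : ℕ → H10 Ω := fun n ↦ η₁ n - interpSlope q (𝓜.t n) (𝓜.t (n + 1)) u₁
  let W₂ : ℕ → H10 Ω := fun n ↦ η₂ n - interpSlope q (𝓜.t n) (𝓜.t (n + 1)) u₂
  -- The full error at the nodes. For n ≥ 1 it is the left limit of θ, because ρ vanishes at right
  -- end points; for n = 0 it is zero because both solutions have the same initial value.
  let E₁ : ℕ → H10 Ω := fun n ↦ U₁ (𝓜.t n) - u₁ (𝓜.t n)
  let E₂ : ℕ → H10 Ω := fun n ↦ U₂ (𝓜.t n) - u₂ (𝓜.t n)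
  have hmain := stability 𝓜.N (fun n ↦ ‖T₁ (E₁ n)‖) (fun n ↦ ‖T₀ (E₂ n)‖)
    (fun n ↦ ‖T₁ (E₁ (n + 1) - 𝓜.step n • W₁ n - E₁ n)‖)
    (fun n ↦ ‖T₀ (E₂ (n + 1) - 𝓜.step n • W₂ n - E₂ n)‖)
    (fun n ↦ ‖T₁ (E₁ (n + 1) - 𝓜.step n • W₁ n)‖)
    (fun n ↦ ‖T₀ (E₂ (n + 1) - 𝓜.step n • W₂ n)‖) (fun m ↦ 𝓜.step m * (R₁ m + R₂ m))
    (fun _ ↦ norm_nonneg _)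
    (by simp [E₁, 𝓜.t_zero, h.2.1, hU.2.2.1]) (by simp [E₂, 𝓜.t_zero, h.2.2, hU.2.2.2])
    (fun n hn ↦ mul_nonneg (𝓜.step_pos hn).le (add_nonneg (hR₁0 n hn) (hR₂0 n hn)))
    (fun n _ ↦ by
      rw [map_sub _ (_ - _) (E₁ n)]
      exact norm_le_norm_add_norm_sub' _ _)
    (fun n _ ↦ by
      rw [map_sub _ (_ - _) (E₂ n)]
      exact norm_le_norm_add_norm_sub' _ _) ?_
  · intro n hn s hs
    have hs' := Ioc_subset_Icc_self hs
    obtain ⟨m1, m2, m3, m4⟩ := hmain n hn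
    constructor
    · rw [(hU₁ n hn).2 s hs, affine_sub_eq q (𝓜.t n), add_sub_cancel_right, affine_map,
        ← hend U₁ ζ₁ η₁ n hn (hU₁ n hn).2]
      exact norm_affine_le (𝓜.t_lt n hn) m1 (by
        rw [← map_smul, ← map_sub]; exact m3) hs'
    · rw [(hU₂ n hn).2 s hs, affine_sub_eq q (𝓜.t n), add_sub_cancel_right, affine_map,
        ← hend U₂ ζ₂ η₂ n hn (hU₂ n hn).2]
      exact norm_affine_le (𝓜.t_lt n hn) m2 (by
        rw [← map_smul, ← map_sub]; exact m4) hs'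
  · intro n hn M k1 k2 k3 k4
    have hlt := 𝓜.t_lt n hn
    have c1 := (hu₁.2 n hn).continuousOn
    have c2 := (hu₂.2 n hn).continuousOn
    have e1 := hend U₁ ζ₁ η₁ n hn (hU₁ n hn).2
    have e2 := hend U₂ ζ₂ η₂ n hn (hU₂ n hn).2
    have w1 : W₁ n ∈ slopes Ω q := sub_mem (hU₁ n hn).1 (interpSlope_mem_slopes _ _ _)
    have w2 : W₂ n ∈ slopes Ω q := sub_mem (hU₂ n hn).1 (interpSlope_mem_slopes _ _ _)
    obtain ⟨g1, -⟩ := error_equations hq hf hu₁ hu₂ h hU hn (hU₁ n hn).2 (hU₂ n hn).2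
      (S (E₁ (n + 1))) (map_mem_slopes S w1)
    obtain ⟨-, g2⟩ := error_equations hq hf hu₁ hu₂ h hU hn (hU₁ n hn).2 (hU₂ n hn).2
      (S (E₂ (n + 1))) (map_mem_slopes S w2)
    rw [integral_affine_sub_slope (aL Ω) hlt c1 _ _ (map_mem_slopes S w1)] at g1
    rw [integral_affine_sub_slope (ipL Ω) hlt c2 _ _ (map_mem_slopes S w2)] at g2
    simp only [affine_sub_eq q (𝓜.t n)] at g1 g2
    rw [← e1, ← e2] at g1 g2
    exact energy_step hlt hT₁ hT₀ (continuousOn_interpError c1) (continuousOn_interpError c2)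
      g1 g2 (hR₁0 n hn) (hR₂0 n hn) (hR₂ n hn) (hR₁ n hn) k1 k2 k3 k4

end Energy

/-! ### Error estimates -/

/-- Duality: the scalar bound is applied to ⟨x, F ·⟩ with x the image under F of the error itself,
and one factor ‖x‖ is cancelled. -/
lemma norm_interpError_le {K : Type*} [NormedAddCommGroup K] [InnerProductSpace ℝ K]
    (F : H10 Ω →L[ℝ] K) (hq : q = 0 ∨ q = 1) {u : ℝ → H10 Ω} {α b M : ℝ} (hα : α < b)
    (hu : ContDiffOn ℝ (q + 1 : ℕ) u (Icc α b))
    (hM : ∀ s ∈ Ioo α b, ‖F (iteratedDeriv (q + 1) u s)‖ ≤ M) {s : ℝ} (hs : s ∈ Icc α b) :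
    ‖F (interpError q α b u s)‖ ≤ 3 * (b - α) ^ (q + 1) * M := by
  set x := F (interpError q α b u s) with hx
  have hM0 : 0 ≤ M := (norm_nonneg _).trans (hM ((α + b) / 2) ⟨by linarith, by linarith⟩)
  have h := abs_interpError_le hq hα hu ((innerSL ℝ x).comp F) (M := ‖x‖ * M) (fun r hr ↦
    (abs_real_inner_le_norm _ _).trans (mul_le_mul_of_nonneg_left (hM r hr) (norm_nonneg _))) hs
  have h' : ‖x‖ * ‖x‖ ≤ 3 * (b - α) ^ (q + 1) * (‖x‖ * M) := by
    have e : ((innerSL ℝ x).comp F) (interpError q α b u s) = ‖x‖ * ‖x‖ :=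
      real_inner_self_eq_norm_mul_norm x
    rw [e] at h
    exact (le_abs_self _).trans h
  rcases (norm_nonneg x).eq_or_lt with h0 | hpos
  · rw [← h0]
    have := sub_pos.mpr hα
    positivity
  · refine le_of_mul_le_mul_left ?_ hpos
    linarith

lemma enorm_interpError_le {K : Type*} [NormedAddCommGroup K] [InnerProductSpace ℝ K]
    (F : H10 Ω →L[ℝ] K) (hq : q = 0 ∨ q = 1) {u : ℝ → H10 Ω} (hu : IsPiecewiseC 𝓜 (q + 1) u)
    (hn : n < 𝓜.N) {s : ℝ} (hs : s ∈ Icc (𝓜.t n) (𝓜.t (n + 1))) :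
    ‖F (interpError q (𝓜.t n) (𝓜.t (n + 1)) u s)‖ₑ ≤
      3 * (ENNReal.ofReal (𝓜.k ^ (q + 1)) *
        supNorm (fun v ↦ ‖F v‖ₑ) 𝓜.offNodes (iteratedDeriv (q + 1) u)) := by
  set A := supNorm (fun v ↦ ‖F v‖ₑ) 𝓜.offNodes (iteratedDeriv (q + 1) u) with hA
  have hstep := 𝓜.step_pos hn
  have hk : 0 < 𝓜.k := hstep.trans_le (𝓜.step_le_k hn)
  by_cases htop : A = ⊤
  · rw [htop, ENNReal.mul_top (by simpa using pow_pos hk _), ENNReal.mul_top (by simp)]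
    exact le_top
  have hM : ∀ s ∈ Ioo (𝓜.t n) (𝓜.t (n + 1)), ‖F (iteratedDeriv (q + 1) u s)‖ ≤ A.toReal := by
    intro s hs
    rw [← toReal_enorm]
    exact ENNReal.toReal_mono htop (le_iSup₂_of_le s
      (mem_biUnion (Finset.mem_coe.mpr (Finset.mem_range.mpr hn)) hs) le_rfl)
  have h := norm_interpError_le F hq (𝓜.t_lt n hn) (hu.2 n hn) hM hs
  have h2 : 3 * (𝓜.t (n + 1) - 𝓜.t n) ^ (q + 1) * A.toReal ≤
      3 * (𝓜.k ^ (q + 1) * A.toReal) := by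
    rw [mul_assoc]
    gcongr
    · exact 𝓜.step_le_k hn
  rw [← ofReal_norm]
  refine (ENNReal.ofReal_le_ofReal (h.trans h2)).trans (le_of_eq ?_)
  rw [ENNReal.ofReal_mul (by norm_num), ENNReal.ofReal_mul (by positivity),
    ENNReal.ofReal_toReal htop]
  norm_num

variable {K₁ K₀ : Type*} [NormedAddCommGroup K₁] [InnerProductSpace ℝ K₁]
  [NormedAddCommGroup K₀] [InnerProductSpace ℝ K₀]
  {S : H10 Ω →L[ℝ] H10 Ω} {T₁ : H10 Ω →L[ℝ] K₁} {T₀ : H10 Ω →L[ℝ] K₀}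

lemma abs_le_of_ofReal_le {x y M : ℝ} {A : ℝ≥0∞} (hM : A ≤ ENNReal.ofReal M) (hM0 : 0 ≤ M)
    (hy : 0 ≤ y) (h : ENNReal.ofReal |x| ≤ A * ENNReal.ofReal y) : |x| ≤ M * y := by
  rw [← ENNReal.ofReal_le_ofReal_iff (by positivity), ENNReal.ofReal_mul hM0]
  exact h.trans (mul_le_mul_left hM _)

/-- The error estimate in the norms determined by `T₁` and `T₀`. -/
lemma error_bound (hq : q = 0 ∨ q = 1) (hf : IntegrableOn f (Ioo 0 T))
    (hu₁ : IsPiecewiseC 𝓜 (q + 1) u₁) (hu₂ : IsPiecewiseC 𝓜 (q + 1) u₂)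
    (h : IsWaveSolution 𝓜 f u₀ v₀ u₁ u₂) (hU : IsDGSolution 𝓜 q f u₀ v₀ U₁ U₂)
    (hT₁ : ∀ v w, a v (S w) = inner ℝ (T₁ v) (T₁ w))
    (hT₀ : ∀ v w, ip v (S w) = inner ℝ (T₀ v) (T₀ w))
    {ν : H10 Ω → ℝ≥0∞} (hν : ∀ v c, ENNReal.ofReal |a v (S c)| ≤ ν v * ‖T₀ c‖ₑ) {Q₁ Q₂ : ℝ≥0∞}
    (hQ₂ : Q₂ = ∑ n ∈ Finset.range 𝓜.N, ENNReal.ofReal (𝓜.step n ^ (q + 2)) *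
      supNorm (fun v ↦ ‖T₁ v‖ₑ) (𝓜.I n) (iteratedDeriv (q + 1) u₂))
    (hQ₁ : Q₁ = ∑ n ∈ Finset.range 𝓜.N, ENNReal.ofReal (𝓜.step n ^ (q + 2)) *
      supNorm ν (𝓜.I n) (iteratedDeriv (q + 1) u₁)) :
    supNorm (fun v ↦ ‖T₁ v‖ₑ) (Ioo 0 T) (U₁ - u₁) ≤
      3 * (ENNReal.ofReal (𝓜.k ^ (q + 1)) *
        supNorm (fun v ↦ ‖T₁ v‖ₑ) 𝓜.offNodes (iteratedDeriv (q + 1) u₁)) + 24 * (Q₂ + Q₁) ∧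
    supNorm (fun v ↦ ‖T₀ v‖ₑ) (Ioo 0 T) (U₂ - u₂) ≤
      3 * (ENNReal.ofReal (𝓜.k ^ (q + 1)) *
        supNorm (fun v ↦ ‖T₀ v‖ₑ) 𝓜.offNodes (iteratedDeriv (q + 1) u₂)) + 24 * (Q₂ + Q₁) := by
  -- The weights are nonzero, so an infinite supremum on one subinterval makes the sum infinite and
  -- the claim trivial. Otherwise all suprema are finite and the estimates can be made in ℝ.
  have hpos (n : ℕ) (hn : n < 𝓜.N) : ENNReal.ofReal (𝓜.step n ^ (q + 2)) ≠ 0 := by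
    simpa using pow_pos (𝓜.step_pos hn) _
  by_cases htop₂ : Q₂ = ⊤
  · simp [htop₂]
  by_cases htop₁ : Q₁ = ⊤
  · simp [htop₁]
  set A₂ : ℕ → ℝ≥0∞ := fun n ↦ supNorm (fun v ↦ ‖T₁ v‖ₑ) (𝓜.I n) (iteratedDeriv (q + 1) u₂)
  set A₁ : ℕ → ℝ≥0∞ := fun n ↦ supNorm ν (𝓜.I n) (iteratedDeriv (q + 1) u₁)
  have hA₂ (n : ℕ) (hn : n < 𝓜.N) : A₂ n ≠ ⊤ := by
    intro hA
    refine htop₂ (hQ₂.trans (ENNReal.sum_eq_top.mpr ⟨n, Finset.mem_range.mpr hn, ?_⟩))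
    rw [show supNorm _ (𝓜.I n) _ = ⊤ from hA, ENNReal.mul_top (hpos n hn)]
  have hA₁ (n : ℕ) (hn : n < 𝓜.N) : A₁ n ≠ ⊤ := by
    intro hA
    refine htop₁ (hQ₁.trans (ENNReal.sum_eq_top.mpr ⟨n, Finset.mem_range.mpr hn, ?_⟩))
    rw [show supNorm _ (𝓜.I n) _ = ⊤ from hA, ENNReal.mul_top (hpos n hn)]
  have hbd := energy_bound hq hf hu₁ hu₂ h hU hT₁ hT₀
    (R₁ := fun n ↦ 3 * 𝓜.step n ^ (q + 1) * (A₁ n).toReal)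
    (R₂ := fun n ↦ 3 * 𝓜.step n ^ (q + 1) * (A₂ n).toReal)
    (fun n hn ↦ by have := 𝓜.step_pos hn; positivity)
    (fun n hn ↦ by have := 𝓜.step_pos hn; positivity)
    (fun n hn s hs ↦ norm_interpError_le T₁ hq (𝓜.t_lt n hn) (hu₂.2 n hn) (fun r hr ↦ by
      rw [← toReal_enorm]
      exact ENNReal.toReal_mono (hA₂ n hn) (le_iSup₂_of_le r hr le_rfl)) hs)
    -- The scalar interpolation bound for the functional a(·, Sc), whose value at the derivative of
    -- u₁ is controlled by ν.
    (fun n hn s hs c ↦ by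
      have := abs_interpError_le hq (𝓜.t_lt n hn) (hu₁.2 n hn) ((aL Ω).flip (S c))
        (M := (A₁ n).toReal * ‖T₀ c‖) (fun r hr ↦ by
          refine abs_le_of_ofReal_le ?_ ENNReal.toReal_nonneg (norm_nonneg _)
            (ofReal_norm (T₀ c) ▸ hν (iteratedDeriv (q + 1) u₁ r) c)
          rw [ENNReal.ofReal_toReal (hA₁ n hn)]
          exact le_iSup₂_of_le r hr le_rfl) hs
      rw [← mul_assoc] at this
      exact this)
  -- The constant 24 is 8 from stability times 3 from interpolation; the step length raises the
  -- power q + 1 to q + 2.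
  have hsum : ENNReal.ofReal (8 * ∑ m ∈ Finset.range 𝓜.N, 𝓜.step m *
      (3 * 𝓜.step m ^ (q + 1) * (A₁ m).toReal + 3 * 𝓜.step m ^ (q + 1) * (A₂ m).toReal)) =
      24 * (Q₂ + Q₁) := by
    have e : 8 * ∑ m ∈ Finset.range 𝓜.N, 𝓜.step m *
        (3 * 𝓜.step m ^ (q + 1) * (A₁ m).toReal + 3 * 𝓜.step m ^ (q + 1) * (A₂ m).toReal) =
        24 * ∑ m ∈ Finset.range 𝓜.N,
          (𝓜.step m ^ (q + 2) * (A₂ m).toReal + 𝓜.step m ^ (q + 2) * (A₁ m).toReal) := by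
      rw [Finset.mul_sum, Finset.mul_sum]
      exact Finset.sum_congr rfl fun m _ ↦ by ring
    have hs (m : ℕ) (hm : m ∈ Finset.range 𝓜.N) : 0 ≤ 𝓜.step m :=
      (𝓜.step_pos (Finset.mem_range.mp hm)).le
    rw [e, ENNReal.ofReal_mul (by norm_num), ENNReal.ofReal_sum_of_nonneg fun m hm ↦ by
      have := hs m hm; positivity, hQ₁, hQ₂, ← Finset.sum_add_distrib]
    congr 1
    · norm_num
    · refine Finset.sum_congr rfl fun m hm ↦ ?_
      have h0 := hs m hm
      have hm' := Finset.mem_range.mp hm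
      rw [ENNReal.ofReal_add (by positivity) (by positivity), ENNReal.ofReal_mul (by positivity),
        ENNReal.ofReal_mul (by positivity), ENNReal.ofReal_toReal (hA₁ m hm'),
        ENNReal.ofReal_toReal (hA₂ m hm')]
  rw [← hsum]
  constructor
  · refine iSup₂_le fun s hs ↦ ?_
    obtain ⟨n, hn, hsn⟩ := 𝓜.exists_mem_Ioc hs
    have h1 := enorm_interpError_le T₁ hq hu₁ hn (Ioc_subset_Icc_self hsn)
    have h2 := ENNReal.ofReal_le_ofReal (hbd n hn s hsn).1
    rw [ofReal_norm, map_sub] at h2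
    -- The triangle inequality for e = ρ + θ.
    refine le_trans ?_ (add_le_add h1 h2)
    refine le_trans (le_of_eq ?_) (enorm_add_le _ _)
    rw [add_sub_cancel]; rfl
  · refine iSup₂_le fun s hs ↦ ?_
    obtain ⟨n, hn, hsn⟩ := 𝓜.exists_mem_Ioc hs
    have h1 := enorm_interpError_le T₀ hq hu₂ hn (Ioc_subset_Icc_self hsn)
    have h2 := ENNReal.ofReal_le_ofReal (hbd n hn s hsn).2
    rw [ofReal_norm, map_sub] at h2
    refine le_trans ?_ (add_le_add h1 h2)
    refine le_trans (le_of_eq ?_) (enorm_add_le _ _)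
    rw [add_sub_cancel]; rfl

end DGWave

end

/-! ### The theorem: two choices of the operator S -/

open DGWave
theorem mainTheorem2 (d : ℕ) (hd : d = 1 ∨ d = 2 ∨ d = 3)
    (Ω : Set (EuclideanSpace ℝ (Fin d))) (hΩ : IsConvexPolygonalDomain Ω)
    (q : ℕ) (hq : q = 0 ∨ q = 1) :
    ∃ C : ℝ≥0, 0 < C ∧
      ∀ (T : ℝ) (𝓜 : TimeMesh T) (f : ℝ → L2 Ω) (u₀ v₀ : H10 Ω) (u₁ u₂ U₁ U₂ : ℝ → H10 Ω),
        MeasureTheory.IntegrableOn f (Set.Ioo 0 T) →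
        IsPiecewiseC 𝓜 (q + 1) u₁ → IsPiecewiseC 𝓜 (q + 1) u₂ →
        IsWaveSolution 𝓜 f u₀ v₀ u₁ u₂ →
        IsDGSolution 𝓜 q f u₀ v₀ U₁ U₂ →
        (supNorm norm1 (Set.Ioo 0 T) (U₁ - u₁) + supNorm norm0 (Set.Ioo 0 T) (U₂ - u₂) ≤
          C * (ENNReal.ofReal (𝓜.k ^ (q + 1)) *
                supNorm norm1 𝓜.offNodes (iteratedDeriv (q + 1) u₁) +
              ENNReal.ofReal (𝓜.k ^ (q + 1)) *
                supNorm norm0 𝓜.offNodes (iteratedDeriv (q + 1) u₂) +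
              ∑ n ∈ Finset.range 𝓜.N, ENNReal.ofReal (𝓜.step n ^ (q + 2)) *
                supNorm norm1 (𝓜.I n) (iteratedDeriv (q + 1) u₂) +
              ∑ n ∈ Finset.range 𝓜.N, ENNReal.ofReal (𝓜.step n ^ (q + 2)) *
                supNorm norm2 (𝓜.I n) (iteratedDeriv (q + 1) u₁))) ∧
        (supNorm norm0 (Set.Ioo 0 T) (U₁ - u₁) ≤
          C * (ENNReal.ofReal (𝓜.k ^ (q + 1)) *
                supNorm norm0 𝓜.offNodes (iteratedDeriv (q + 1) u₁) +
              ∑ n ∈ Finset.range 𝓜.N, ENNReal.ofReal (𝓜.step n ^ (q + 2)) *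
                supNorm norm0 (𝓜.I n) (iteratedDeriv (q + 1) u₂) +
              ∑ n ∈ Finset.range 𝓜.N, ENNReal.ofReal (𝓜.step n ^ (q + 2)) *
                supNorm norm1 (𝓜.I n) (iteratedDeriv (q + 1) u₁))) := by
  obtain ⟨G, hG⟩ := exists_inverse_laplacian (Ω := Ω) (by omega) hΩ.isBounded
  -- Each component contributes 24(Q₂ + Q₁), and the first estimate adds two components.
  refine ⟨48, by norm_num, fun T 𝓜 f u₀ v₀ u₁ u₂ U₁ U₂ hf hu₁ hu₂ h hU ↦ ⟨?_, ?_⟩⟩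
  -- Energy norms: S = id, and |a(v, c)| ≤ ‖Av‖ ‖c‖ makes ‖·‖₂ the seminorm for u₁.
  · obtain ⟨h1, h2⟩ := error_bound (S := ContinuousLinearMap.id ℝ (H10 Ω)) (T₁ := gradL Ω)
      (T₀ := fnL Ω) (ν := norm2) hq hf hu₁ hu₂ h hU (fun _ _ ↦ rfl) (fun _ _ ↦ rfl)
      (fun v c ↦ ofReal_abs_a_le v c) rfl rfl
    refine (add_le_add h1 h2).trans ?_
    have h3 : (3 : ℝ≥0∞) ≤ 48 := by norm_num
    have e (x y s t : ℝ≥0∞) : 3 * x + 24 * (s + t) + (3 * y + 24 * (s + t)) ≤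
        ((48 : ℝ≥0) : ℝ≥0∞) * (x + y + s + t) := by
      calc 3 * x + 24 * (s + t) + (3 * y + 24 * (s + t)) = 3 * x + 3 * y + 48 * s + 48 * t := by ring
        _ ≤ 48 * x + 48 * y + 48 * s + 48 * t := by gcongr
        _ = _ := by push_cast; ring
    exact e _ _ _ _
  -- One order lower: a(v, Gw) = (v, w) and (v, Gw) = (∇Gv, ∇Gw), while |a(v, Gc)| ≤ ‖∇v‖ ‖∇Gc‖
  -- replaces ‖·‖₂ by ‖·‖₁. The bound for e₂ in the dual-type norm ‖∇G·‖ is discarded.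
  · obtain ⟨h1, -⟩ := error_bound (S := G) (T₁ := fnL Ω) (T₀ := (gradL Ω).comp G) (ν := norm1)
      hq hf hu₁ hu₂ h hU (fun v w ↦ hG w v)
      (fun v w ↦ by
        rw [show ip v (G w) = ip (G w) v from real_inner_comm _ _, ← hG]
        exact real_inner_comm _ _)
      (fun v c ↦ by
        rw [norm1, ← ofReal_norm, ← ofReal_norm, ← ENNReal.ofReal_mul (norm_nonneg _)]
        exact ENNReal.ofReal_le_ofReal (abs_real_inner_le_norm _ _)) rfl rfl
    refine h1.trans ?_
    have e (x s t : ℝ≥0∞) : 3 * x + 24 * (s + t) ≤ ((48 : ℝ≥0) : ℝ≥0∞) * (x + s + t) := by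
      have h3 : (3 : ℝ≥0∞) ≤ 48 := by norm_num
      have h24 : (24 : ℝ≥0∞) ≤ 48 := by norm_num
      calc 3 * x + 24 * (s + t) ≤ 48 * x + 48 * (s + t) := by gcongr
        _ = _ := by push_cast; ring
    exact e _ _ _
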